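/- Let $\mathbb F$ be a field of characteristic zero. An algebraic circuit is a directed acyclic graph with leaves labelled by variables or constants of $\mathbb F$ and internal nodes labelled $+$ or $\times$ (unbounded fan-in); its size is the number of edges and its depth the length of the longest path from a leaf to the output. For $n,\sigma,\mu,\rho\in\mathbb N$, an $(n,\sigma,\mu,\rho)$-design is a family $\mathcal S=(S_1,\dots,S_n)$ of subsets of $\{1,\dots,\mu\}$ with $|S_i|=\sigma$ for all $i$ and $|S_i\cap S_j|<\rho$ for all $i\ne j$. For a polynomial $g$ in $\sigma$ variables, put $\mathbf{KI}_{g,\mathcal S}(\mathbf w)=(g(\mathbf w_{S_1}),\dots,g(\mathbf w_{S_n}))$, where $\mathbf w=(w_1,\dots,w_\mu)$ and $\mathbf w_{S}=(w_j)_{j\in S}$ in increasing order of $j$. **Theorem.** There is an absolute constant $c$ such that the following holds. Let $k>1$ be a natural number, $\mathbf x=(x_1,\dots,x_n)$, and let $A(T,\mathbf x,z)\in\mathbb F[T,\mathbf x,z]$ and $\Phi(T,\mathbf x)\in\mathbb F[T,\mathbf x]$ be such that * $A$ is computable by a circuit of depth $\Delta$ and size $s$; * $A$ is $T$-regularized (every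 monomial of $A$ that depends on $\mathbf x$ is divisible by $T$) and monic in $z$ (the leading coefficient of $A$ in $z$ is a nonzero constant of $\mathbb F$); * $\Phi$ is a truncated, non-degenerate, approximate $z$-root of $A$ of order $k$, that is, $\deg_T\Phi<k$, $(\partial_zA)(0,\mathbf 0,\Phi(0,\mathbf 0))\neq0$ and $A(T,\mathbf x,\Phi(T,\mathbf x))\equiv0\bmod T^k$. Let $\mathcal S$ be an $(n,\sigma,\mu,\rho)$-design and let $g$ be a $\sigma$-variate polynomial over $\mathbb F$ of degree $d$. Put $\Delta'=\Delta+c$ and $$s'=c\,(s+\deg A+k)^{c}\cdot(\rho\log_2 k)^{c(d+1)^{c}}=\operatorname{poly}(s,\deg A,k)\cdot(\rho\log k)^{\operatorname{poly}(d)}.$$ 1. If $A(T,\mathbf x,\Phi(T,\mathbf x))\not\equiv0$ and $A(T,\mathbf{KI}_{g,\mathcal S}(\mathbf w),\Phi(T,\mathbf{KI}_{g,\mathcal S}(\mathbf w)))\equiv0$, then $g$ can be computed by a circuit of depth at most $\Delta'$ and size at most $s'$. 2. In particular, if $g$ cannot be computed by a circuit of depth at most $\Delta'$ and size at most $s'$,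 then $A(T,\mathbf{KI}_{g,\mathcal S}(\mathbf w),\Phi(T,\mathbf{KI}_{g,\mathcal S}(\mathbf w)))\equiv0$ if and only if $A(T,\mathbf x,\Phi(T,\mathbf x))\equiv0$. -/

import Mathlib

noncomputable section

/-! ### Algebraic circuits -/

/-- The label of a node of an algebraic circuit with node set `V`: a leaf carrying a variable or a
field constant, or a sum / product gate together with the multiset of its in-neighbours.
Fan-in is unbounded; a node may be used several times by the same gate, each use being an edge.
A gate without inputs is an (inessential) way to write the constant `0` or `1`. -/
inductive CircuitGate (F : Type*) (X : Type*) (V : Type*) where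
  | var (x : X) : CircuitGate F X V
  | const (c : F) : CircuitGate F X V
  | sum (ch : Multiset V) : CircuitGate F X V
  | prod (ch : Multiset V) : CircuitGate F X V

namespace CircuitGate

/-- The multiset of in-neighbours of a node. -/
def children {F X V : Type*} : CircuitGate F X V → Multiset V
  | var _ => 0
  | const _ => 0
  | sum ch => ch
  | prod ch => ch

/-- The polynomial at a node, given the polynomials at its in-neighbours. -/
def value {F X V : Type*} [CommSemiring F] (val : V → MvPolynomial X F) :
    CircuitGate F X V → MvPolynomial X F
  | var x => MvPolynomial.X x
  | const c => MvPolynomial.C c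
  | sum ch => (ch.map val).sum
  | prod ch => (ch.map val).prod

theorem value_congr {F X V : Type*} [CommSemiring F] {val val' : V → MvPolynomial X F}
    (G : CircuitGate F X V) (h : ∀ u ∈ G.children, val u = val' u) :
    G.value val = G.value val' := by
  cases G with
  | var x => rfl
  | const c => rfl
  | sum ch => exact congrArg Multiset.sum (Multiset.map_congr rfl h)
  | prod ch => exact congrArg Multiset.prod (Multiset.map_congr rfl h)

end CircuitGate

/-- A (division-free) algebraic circuit over `F` in the variables `X`: a finite directed acyclic
graph whose nodes are labelled as above, with a designated output node.  For a finite graph,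
acyclicity is the same as well-foundedness of the edge relation. -/
structure AlgCircuit (F : Type*) (X : Type*) where
  V : Type
  instFintype : Fintype V
  gate : V → CircuitGate F X V
  acyclic : WellFounded fun u v : V => u ∈ (gate v).children
  out : V

namespace AlgCircuit

variable {F : Type*} {X : Type*}

open scoped Classical in
/-- The polynomial computed at a node. -/
def polyAt [CommSemiring F] (K : AlgCircuit F X) : K.V → MvPolynomial X F :=
  K.acyclic.fix fun v ih =>
    (K.gate v).value fun u => if h : u ∈ (K.gate v).children then ih u h else 0

/-- The defining recursion of `polyAt`. -/
theorem polyAt_eq [CommSemiring F] (K : AlgCircuit F X) (v : K.V) :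
    K.polyAt v = (K.gate v).value K.polyAt := by
  unfold polyAt
  rw [WellFounded.fix_eq]
  apply CircuitGate.value_congr
  intro u hu
  simp [hu]

/-- The polynomial computed by a circuit. -/
def poly [CommSemiring F] (K : AlgCircuit F X) : MvPolynomial X F := K.polyAt K.out

open scoped Classical in
/-- The length of the longest directed path from a leaf to a given node. -/
def depthAt (K : AlgCircuit F X) : K.V → ℕ :=
  K.acyclic.fix fun v ih =>
    ((K.gate v).children.map fun u =>
      if h : u ∈ (K.gate v).children then ih u h + 1 else 0).sup

/-- The defining recursion of `depthAt`. -/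
theorem depthAt_eq (K : AlgCircuit F X) (v : K.V) :
    K.depthAt v = ((K.gate v).children.map fun u => K.depthAt u + 1).sup := by
  unfold depthAt
  rw [WellFounded.fix_eq]
  congr 1
  apply Multiset.map_congr rfl
  intro u hu
  simp [hu]

/-- The depth of a circuit: the length of the longest path from a leaf to the output node. -/
def depth (K : AlgCircuit F X) : ℕ := K.depthAt K.out

/-- The size of a circuit: the number of its edges. -/
def size (K : AlgCircuit F X) : ℕ :=
  letI := K.instFintype
  ∑ v : K.V, Multiset.card (K.gate v).children

end AlgCircuit

/-- `f` is computed by an algebraic circuit of depth at most `Δ` and size at most `s`. -/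
def ComputableBy {F : Type*} {X : Type*} [CommSemiring F]
    (f : MvPolynomial X F) (Δ : ℕ) (s : ℝ) : Prop :=
  ∃ K : AlgCircuit F X, K.poly = f ∧ K.depth ≤ Δ ∧ (K.size : ℝ) ≤ s

/-! ### Polynomials in `T, x, z` and their approximate roots -/

/-- The variables of `F[T, x]`, where `x = (x i)_{i : ι}`. -/
inductive VarTX (ι : Type*) where
  | T : VarTX ι
  | x (i : ι) : VarTX ι

/-- The variables of `F[T, x, z]`, where `x = (x i)_{i : ι}`. -/
inductive VarTXZ (ι : Type*) where
  | T : VarTXZ ι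
  | x (i : ι) : VarTXZ ι
  | z : VarTXZ ι

section Roots

variable {F : Type*} [Field F] {ι κ : Type*}

/-- The substitution `P(T, x, z) ↦ P(T, x, Φ(T, x))`. -/
def substZ (P : MvPolynomial (VarTXZ ι) F) (Φ : MvPolynomial (VarTX ι) F) :
    MvPolynomial (VarTX ι) F :=
  MvPolynomial.aeval (fun v : VarTXZ ι => match v with
    | .T => MvPolynomial.X .T
    | .x i => MvPolynomial.X (.x i)
    | .z => Φ) P

/-- `P(T, x, z)` viewed as a univariate polynomial in `z` with coefficients in `F[T, x]`. -/
def asPolyInZ (P : MvPolynomial (VarTXZ ι) F) : Polynomial (MvPolynomial (VarTX ι) F) :=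
  MvPolynomial.aeval (fun v : VarTXZ ι => match v with
    | .T => Polynomial.C (MvPolynomial.X .T)
    | .x i => Polynomial.C (MvPolynomial.X (.x i))
    | .z => Polynomial.X) P

/-- `P` is monic in `z`: its leading coefficient in `z` is a nonzero field constant. -/
def MonicInZ (P : MvPolynomial (VarTXZ ι) F) : Prop :=
  ∃ c : F, c ≠ 0 ∧ (asPolyInZ P).leadingCoeff = MvPolynomial.C c

/-- `P` is `T`-regularized: every monomial of `P` that depends on `x` is divisible by `T`. -/
def TRegularized (P : MvPolynomial (VarTXZ ι) F) : Prop :=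
  ∀ m ∈ P.support, (∃ i : ι, m (.x i) ≠ 0) → m .T ≠ 0

/-- `Φ` is an approximate `z`-root of `P` of order `k`: `P(T, x, Φ(T, x)) ≡ 0 mod T ^ k`. -/
def IsApproxRoot (P : MvPolynomial (VarTXZ ι) F) (Φ : MvPolynomial (VarTX ι) F) (k : ℕ) : Prop :=
  (MvPolynomial.X .T : MvPolynomial (VarTX ι) F) ^ k ∣ substZ P Φ

/-- `Φ` is truncated at order `k`: its `T`-degree is less than `k`. -/
def IsTruncated (Φ : MvPolynomial (VarTX ι) F) (k : ℕ) : Prop :=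
  Φ.degreeOf .T < k

/-- `Φ` is non-degenerate for `P`: `(∂P/∂z)(0, 0, α) ≠ 0`, where `α = Φ(0, 0)`. -/
def IsNondegenerate (P : MvPolynomial (VarTXZ ι) F) (Φ : MvPolynomial (VarTX ι) F) : Prop :=
  MvPolynomial.eval (fun v : VarTXZ ι => match v with
    | .T => 0
    | .x _ => 0
    | .z => MvPolynomial.eval (fun _ => 0) Φ) (MvPolynomial.pderiv .z P) ≠ 0

/-- The substitution `Q(T, x) ↦ Q(T, h(w))` for a polynomial map `h = (h i)_{i : ι}`. -/
def substXInTX (h : ι → MvPolynomial κ F) (Q : MvPolynomial (VarTX ι) F) :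
    MvPolynomial (VarTX κ) F :=
  MvPolynomial.aeval (fun v : VarTX ι => match v with
    | .T => MvPolynomial.X .T
    | .x i => MvPolynomial.rename VarTX.x (h i)) Q

/-- The substitution `P(T, x, z) ↦ P(T, h(w), z)` for a polynomial map `h = (h i)_{i : ι}`. -/
def substXInTXZ (h : ι → MvPolynomial κ F) (P : MvPolynomial (VarTXZ ι) F) :
    MvPolynomial (VarTXZ κ) F :=
  MvPolynomial.aeval (fun v : VarTXZ ι => match v with
    | .T => MvPolynomial.X .T
    | .x i => MvPolynomial.rename VarTXZ.x (h i)
    | .z => MvPolynomial.X .z) P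

end Roots

/-! ### Designs and the Kabanets–Impagliazzo generator -/

/-- An `(n, σ, μ, ρ)`-design: `n` subsets of `[μ]` of size `σ` whose pairwise intersections have
fewer than `ρ` elements. -/
structure Design (n σ μ ρ : ℕ) where
  S : Fin n → Finset (Fin μ)
  card_eq : ∀ i, (S i).card = σ
  inter_lt : ∀ i j, i ≠ j → (S i ∩ S j).card < ρ

/-- The Kabanets–Impagliazzo generator `w ↦ (g(w_{S_1}), …, g(w_{S_n}))`; the variables in each
`S_i` are taken in increasing order. -/
def KI {F : Type*} [Field F] {n σ μ ρ : ℕ} (g : MvPolynomial (Fin σ) F) (𝒮 : Design n σ μ ρ) :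
    Fin n → MvPolynomial (Fin μ) F :=
  fun i => MvPolynomial.rename ((𝒮.S i).orderEmbOfFin (𝒮.card_eq i)) g

/-- The size bound `poly(s, D, k) · (ρ log k) ^ poly(d)`, with both polynomials normalized by one
constant `c`: any polynomial with natural coefficients in `(s, D, k)`, resp. in `d`, is at most
`c * (s + D + k) ^ c` for `k ≥ 1`, resp. `c * (d + 1) ^ c`, once `c` is large. -/
def rootSizeBound (c s D k ρ d : ℕ) : ℝ :=
  (c * (s + D + k) ^ c : ℕ) * ((ρ : ℝ) * Real.logb 2 k) ^ (c * (d + 1) ^ c)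

end

/-!
A polynomial that vanishes on the Kabanets–Impagliazzo generator yields, by the hybrid argument, a
nonzero univariate polynomial `p` over `F[w]` of which `g` is a root, so everything comes down to
computing roots by circuits whose depth exceeds that of the given polynomial by a constant only.
Newton iteration is too deep for this. A truncated form of Lagrange inversion does it: if
`φ ≡ 0 mod t` solves `φ = H(φ)`, where `t` divides the two lowest coefficients of `H`, then modulo
`t ^ k` the root is the finite sum of `(1 / m) * [z ^ (m - 1)] H ^ m`
(`Polynomial.pow_dvd_sub_sum_of_pow_dvd`). As powers are single product gates and coefficients are
obtained by interpolation (`Comp.of_eval`), this is a circuit of constant additional depth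
(`Comp.coeff_of_approxRoot`).

The formula is used twice. For `φ = Φ - Φ(0, 0)` it gives small circuits for the coefficients of
`A(T, x, Φ(T, x))` with respect to `T` (`Comp.coeff_viewT_substZ`); if this polynomial is nonzero and killed by the
generator, so is one of these coefficients, which is a polynomial `q` in `x` alone. The hybrid
argument (`exists_hybrid`) turns `q` into a polynomial `p` with root `g`; its evaluation involves
only restrictions of `g` to fewer than `ρ` variables, which have at most `ρ ^ d` monomials. In
characteristic zero some derivative of `p` has `g` as a simple root, and along a line
`w = a + τ (w - a)` through a suitable point `a` this root is again given by the inversion formula,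
now modulo `τ ^ (d + 1)` (`Comp.of_root`, `Comp.of_KI_eq_zero`). The size obtained is polynomial in
`(s + deg A + k) * ρ ^ (d + 1)`, which is within the claimed bound once `ρ ≥ 2`; for `ρ ≤ 1` a
nonconstant `g` never kills `q` (`exists_eq_C_of_KI_eq_zero`).
-/

noncomputable section

/-! ### Combining circuits -/

section Circuits

variable {F : Type*} {X : Type*}

namespace CircuitGate

/-- Relabelling of the in-neighbours of a gate. -/
def mapNodes {V W : Type*} (φ : V → W) : CircuitGate F X V → CircuitGate F X W
  | var x => var x
  | const c => const c
  | sum ch => sum (ch.map φ)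
  | prod ch => prod (ch.map φ)

theorem children_mapNodes {V W : Type*} (φ : V → W) (G : CircuitGate F X V) :
    (G.mapNodes φ).children = G.children.map φ := by
  cases G <;> rfl

theorem value_mapNodes [CommSemiring F] {V W : Type*} (φ : V → W) (G : CircuitGate F X V)
    (val : W → MvPolynomial X F) : (G.mapNodes φ).value val = G.value (val ∘ φ) := by
  cases G <;> simp [mapNodes, value]

end CircuitGate

/-- The data of a circuit in a form convenient for gluing: acyclicity is witnessed by a rank
function, which also bounds the depth at the output `o`, and the polynomial `val v` at every node
is part of the data. -/
structure RankedCircuit [CommSemiring F] (f : MvPolynomial X F) (Δ s : ℕ) where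
  V : Type
  inst : Fintype V
  gate : V → CircuitGate F X V
  rank : V → ℕ
  val : V → MvPolynomial X F
  o : V
  rank_lt : ∀ v, ∀ u ∈ (gate v).children, rank u < rank v
  val_eq : ∀ v, val v = (gate v).value val
  val_out : val o = f
  rank_out : rank o ≤ Δ
  size_le : ∑ v, Multiset.card (gate v).children ≤ s

theorem RankedCircuit.computableBy [CommSemiring F] {f : MvPolynomial X F} {Δ s : ℕ}
    (C : RankedCircuit f Δ s) : ComputableBy f Δ (s : ℝ) := by
  have wf : WellFounded fun u v : C.V => u ∈ (C.gate v).children :=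
    Subrelation.wf (r := fun u v => C.rank u < C.rank v) (fun {u v} h => C.rank_lt v u h)
      (InvImage.wf C.rank Nat.lt_wfRel.wf)
  let K : AlgCircuit F X := ⟨C.V, C.inst, C.gate, wf, C.o⟩
  have hval : ∀ v : C.V, K.polyAt v = C.val v := by
    intro v
    induction v using wf.induction with
    | _ v ih =>
      rw [K.polyAt_eq, C.val_eq]
      exact CircuitGate.value_congr _ ih
  have hdepth : ∀ v : C.V, K.depthAt v ≤ C.rank v := by
    intro v
    induction v using wf.induction with
    | _ v ih =>
      rw [K.depthAt_eq, Multiset.sup_le]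
      intro b hb
      obtain ⟨u, hu, rfl⟩ := Multiset.mem_map.1 hb
      exact (Nat.succ_le_succ (ih u hu)).trans (C.rank_lt v u hu)
  refine ⟨K, (hval C.o).trans C.val_out, (hdepth C.o).trans C.rank_out, ?_⟩
  exact_mod_cast C.size_le

theorem ComputableBy.nonempty_ranked [CommSemiring F] {f : MvPolynomial X F} {Δ s : ℕ}
    (h : ComputableBy f Δ (s : ℝ)) : Nonempty (RankedCircuit f Δ s) := by
  obtain ⟨K, hp, hd, hs⟩ := h
  refine ⟨⟨K.V, K.instFintype, K.gate, K.depthAt, K.polyAt, K.out, ?_, K.polyAt_eq, hp, hd, ?_⟩⟩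
  · intro v u hu
    rw [K.depthAt_eq v, ← Nat.succ_le_iff]
    exact Multiset.le_sup (Multiset.mem_map_of_mem (fun u => K.depthAt u + 1) hu)
  · exact_mod_cast hs

theorem ComputableBy.mono [CommSemiring F] {f : MvPolynomial X F} {Δ Δ' : ℕ} {s s' : ℝ}
    (h : ComputableBy f Δ s) (hΔ : Δ ≤ Δ') (hs : s ≤ s') : ComputableBy f Δ' s' := by
  obtain ⟨K, hp, hd, hK⟩ := h
  exact ⟨K, hp, hd.trans hΔ, hK.trans hs⟩

theorem computableBy_C [CommSemiring F] (c : F) (Δ s : ℕ) :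
    ComputableBy (MvPolynomial.C c : MvPolynomial X F) Δ (s : ℝ) :=
  RankedCircuit.computableBy
    { V := Unit, inst := inferInstance, gate := fun _ => .const c, rank := fun _ => 0,
      val := fun _ => MvPolynomial.C c, o := (),
      rank_lt := by simp [CircuitGate.children], val_eq := fun _ => rfl, val_out := rfl,
      rank_out := Nat.zero_le _, size_le := by simp [CircuitGate.children] }

theorem computableBy_X [CommSemiring F] (x : X) (Δ s : ℕ) :
    ComputableBy (MvPolynomial.X x : MvPolynomial X F) Δ (s : ℝ) :=
  RankedCircuit.computableBy
    { V := Unit, inst := inferInstance, gate := fun _ => .var x, rank := fun _ => 0,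
      val := fun _ => MvPolynomial.X x, o := (),
      rank_lt := by simp [CircuitGate.children], val_eq := fun _ => rfl, val_out := rfl,
      rank_out := Nat.zero_le _, size_le := by simp [CircuitGate.children] }

/-- Adding one output gate `G` on top of a disjoint union of circuits. -/
theorem computableBy_gate [CommSemiring F] {ι : Type} [Fintype ι] {f : ι → MvPolynomial X F}
    {Δ s : ℕ} (hf : ∀ i, ComputableBy (f i) Δ (s : ℝ))
    (G : ∀ {V : Type}, Multiset V → CircuitGate F X V)
    (hG : ∀ {V : Type} (m : Multiset V), (G m).children = m)
    (g : MvPolynomial X F)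
    (hg : ∀ {V : Type} (val : V → MvPolynomial X F) (c : ι → V), (∀ i, val (c i) = f i) →
      (G (Finset.univ.val.map c)).value val = g) :
    ComputableBy g (Δ + 1) ((Fintype.card ι * (s + 1) : ℕ) : ℝ) := by
  have K : ∀ i, RankedCircuit (f i) Δ s := fun i => (hf i).nonempty_ranked.some
  let _ : ∀ i, Fintype (K i).V := fun i => (K i).inst
  let c : ι → Option (Σ i, (K i).V) := fun i => some ⟨i, (K i).o⟩
  let val : Option (Σ i, (K i).V) → MvPolynomial X F := fun v =>
    v.elim g fun p => (K p.1).val p.2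
  refine RankedCircuit.computableBy
    { V := Option (Σ i, (K i).V), inst := inferInstance,
      gate := fun v => match v with
        | none => G (Finset.univ.val.map c)
        | some p => ((K p.1).gate p.2).mapNodes fun u => some ⟨p.1, u⟩
      rank := fun v => v.elim (Δ + 1) fun p => (K p.1).rank p.2
      val := val
      o := none
      rank_lt := ?_, val_eq := ?_, val_out := rfl, rank_out := le_rfl, size_le := ?_ }
  · rintro (_ | ⟨i, v⟩) u hu
    · simp only [hG, Multiset.mem_map] at hu
      obtain ⟨i, -, rfl⟩ := hu
      exact Nat.lt_succ_of_le (K i).rank_out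
    · simp only [CircuitGate.children_mapNodes, Multiset.mem_map] at hu
      obtain ⟨w, hw, rfl⟩ := hu
      exact (K i).rank_lt v w hw
  · rintro (_ | ⟨i, v⟩)
    · exact (hg val c fun i => (K i).val_out).symm
    · simp only [CircuitGate.value_mapNodes]
      exact (K i).val_eq v
  · rw [Fintype.sum_option, Fintype.sum_sigma]
    simp only [hG, CircuitGate.children_mapNodes, Multiset.card_map]
    have : ∑ i, ∑ v, Multiset.card ((K i).gate v).children ≤ ∑ _i : ι, s :=
      Finset.sum_le_sum fun i _ => (K i).size_le
    simp only [Finset.sum_const, Finset.card_univ, smul_eq_mul, Finset.card_val] at this ⊢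
    linarith

theorem computableBy_sum [CommSemiring F] {ι : Type} (t : Finset ι) {f : ι → MvPolynomial X F}
    {Δ s : ℕ} (hf : ∀ i ∈ t, ComputableBy (f i) Δ (s : ℝ)) :
    ComputableBy (∑ i ∈ t, f i) (Δ + 1) ((t.card * (s + 1) : ℕ) : ℝ) := by
  have := computableBy_gate (ι := t) (f := fun i => f i) (fun i => hf i i.2)
    (fun m => .sum m) (fun _ => rfl) (∑ i ∈ t, f i) (by
      intro V val c h
      simp only [CircuitGate.value, Multiset.map_map, Function.comp_def, h]
      exact Finset.sum_coe_sort t f)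
  simpa using this

theorem computableBy_prod [CommSemiring F] {ι : Type} (t : Finset ι) {f : ι → MvPolynomial X F}
    {Δ s : ℕ} (hf : ∀ i ∈ t, ComputableBy (f i) Δ (s : ℝ)) :
    ComputableBy (∏ i ∈ t, f i) (Δ + 1) ((t.card * (s + 1) : ℕ) : ℝ) := by
  have := computableBy_gate (ι := t) (f := fun i => f i) (fun i => hf i i.2)
    (fun m => .prod m) (fun _ => rfl) (∏ i ∈ t, f i) (by
      intro V val c h
      simp only [CircuitGate.value, Multiset.map_map, Function.comp_def, h]
      exact Finset.prod_coe_sort t f)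
  simpa using this

open scoped Classical in
/-- Substitution into a circuit. Only the leaves that occur as in-neighbours of some gate (or as the
output) have to be replaced, and there are at most `s + 1` of them, whatever the number of
variables. -/
theorem ComputableBy.aeval [CommSemiring F] {Y : Type*} {f : MvPolynomial X F}
    {h : X → MvPolynomial Y F} {Δ Δ' s s' : ℕ} (hf : ComputableBy f Δ (s : ℝ))
    (hh : ∀ x, ComputableBy (h x) Δ' (s' : ℝ)) :
    ComputableBy (MvPolynomial.aeval h f) (Δ + Δ' + 1)
      ((s + (s + 1) * (s' + 1) : ℕ) : ℝ) := by
  obtain ⟨K⟩ := hf.nonempty_ranked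
  let _ : Fintype K.V := K.inst
  let L : Finset K.V := Finset.univ.filter fun v =>
    (∃ x, K.gate v = .var x) ∧ (v = K.o ∨ ∃ w, v ∈ (K.gate w).children)
  have hL : L.card ≤ s + 1 := by
    have h1 : L ⊆ insert K.o (Finset.univ.biUnion fun w => (K.gate w).children.toFinset) := by
      intro v hv
      simp only [L, Finset.mem_filter, Finset.mem_univ, true_and] at hv
      simpa using hv.2
    refine (Finset.card_le_card h1).trans ((Finset.card_insert_le _ _).trans ?_)
    refine Nat.succ_le_succ (le_trans ?_ K.size_le)
    refine Finset.card_biUnion_le.trans ?_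
    exact Finset.sum_le_sum fun w _ => Multiset.toFinset_card_le (K.gate w).children
  have W : ∀ v : L, RankedCircuit (MvPolynomial.aeval h (K.val v)) Δ' s' := by
    intro v
    have hv := v.2
    simp only [L, Finset.mem_filter, Finset.mem_univ, true_and] at hv
    have : ComputableBy (MvPolynomial.aeval h (K.val v)) Δ' (s' : ℝ) := by
      obtain ⟨x, hx⟩ := hv.1
      rw [K.val_eq, hx]
      simpa [CircuitGate.value] using hh x
    exact this.nonempty_ranked.some
  have hchild : ∀ v w, v ∈ (K.gate w).children → (∃ x, K.gate v = .var x) → v ∈ L := by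
    intro v w hv hx
    simp only [L, Finset.mem_filter, Finset.mem_univ, true_and]
    exact ⟨hx, Or.inr ⟨w, hv⟩⟩
  let _ : ∀ i, Fintype (W i).V := fun i => (W i).inst
  let V' := K.V ⊕ Σ v : L, (W v).V
  let gate' : V' → CircuitGate F Y V' := fun p => match p with
    | .inl v =>
      match K.gate v with
      | .var _ => if hv : v ∈ L then .sum {.inr ⟨⟨v, hv⟩, (W ⟨v, hv⟩).o⟩} else .const 0
      | .const c => .const c
      | .sum ch => .sum (ch.map .inl)
      | .prod ch => .prod (ch.map .inl)
    | .inr p => ((W p.1).gate p.2).mapNodes fun u => .inr ⟨p.1, u⟩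
  let val' : V' → MvPolynomial Y F := fun p => match p with
    | .inl v => if (∃ x, K.gate v = .var x) ∧ v ∉ L then 0 else MvPolynomial.aeval h (K.val v)
    | .inr p => (W p.1).val p.2
  have hval' : ∀ w, ∀ u ∈ (K.gate w).children,
      val' (.inl u) = MvPolynomial.aeval h (K.val u) := by
    intro w u hu
    refine if_neg fun hc => hc.2 (hchild u w hu hc.1)
  refine RankedCircuit.computableBy
    { V := V', inst := inferInstance, gate := gate',
      rank := fun p => match p with
        | .inl v => K.rank v + Δ' + 1
        | .inr p => (W p.1).rank p.2
      val := val', o := .inl K.o,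
      rank_lt := ?_, val_eq := ?_, val_out := ?_, rank_out := ?_, size_le := ?_ }
  · rintro (v | ⟨i, v⟩) u hu
    · simp only [gate'] at hu
      rcases hg : K.gate v with x | c | ch | ch
      · rw [hg] at hu
        by_cases hv : v ∈ L
        · simp only [hv, dite_true, CircuitGate.children, Multiset.mem_singleton] at hu
          subst hu
          have := (W ⟨v, hv⟩).rank_out
          simp only
          omega
        · simp [hv, CircuitGate.children] at hu
      · rw [hg] at hu
        simp [CircuitGate.children] at hu
      all_goals
        rw [hg] at hu
        simp only [CircuitGate.children, Multiset.mem_map] at hu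
        obtain ⟨w, hw, rfl⟩ := hu
        have := K.rank_lt v w (by rw [hg]; exact hw)
        simp only
        omega
    · simp only [gate', CircuitGate.children_mapNodes, Multiset.mem_map] at hu
      obtain ⟨w, hw, rfl⟩ := hu
      exact (W i).rank_lt v w hw
  · rintro (v | ⟨i, v⟩)
    · have hv' := hval' v
      rcases hg : K.gate v with x | c | ch | ch
      · by_cases hv : v ∈ L
        · simp [val', gate', hg, hv, CircuitGate.value, (W ⟨v, hv⟩).val_out]
        · simp [val', gate', hg, hv, CircuitGate.value]
      · simp [val', gate', hg, CircuitGate.value, K.val_eq v, MvPolynomial.algebraMap_eq]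
      · rw [hg] at hv'
        have h1 : val' (.inl v) = MvPolynomial.aeval h (K.val v) := if_neg (by simp [hg])
        rw [h1, K.val_eq v]
        simp only [gate', hg, CircuitGate.value, map_multiset_sum, Multiset.map_map]
        exact congrArg _ (Multiset.map_congr rfl fun u hu => (hv' u hu).symm)
      · rw [hg] at hv'
        have h1 : val' (.inl v) = MvPolynomial.aeval h (K.val v) := if_neg (by simp [hg])
        rw [h1, K.val_eq v]
        simp only [gate', hg, CircuitGate.value, map_multiset_prod, Multiset.map_map]
        exact congrArg _ (Multiset.map_congr rfl fun u hu => (hv' u hu).symm)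
    · simp only [gate', CircuitGate.value_mapNodes]
      exact (W i).val_eq v
  · have : ¬ ((∃ x, K.gate K.o = .var x) ∧ K.o ∉ L) := by
      rintro ⟨hx, hn⟩
      exact hn (Finset.mem_filter.2 ⟨Finset.mem_univ _, hx, .inl rfl⟩)
    simp only [val', if_neg this, K.val_out]
  · have := K.rank_out
    simp only
    omega
  · rw [Fintype.sum_sum_type, Fintype.sum_sigma]
    have h1 : ∑ v, Multiset.card (gate' (.inl v)).children ≤
        ∑ v, (Multiset.card (K.gate v).children + if v ∈ L then 1 else 0) := by
      refine Finset.sum_le_sum fun v _ => ?_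
      simp only [gate']
      rcases hg : K.gate v with x | c | ch | ch
      · by_cases hv : v ∈ L <;> simp [hv, CircuitGate.children]
      all_goals simp [CircuitGate.children]
    have h2 : ∑ v : L, ∑ u, Multiset.card (gate' (.inr ⟨v, u⟩)).children ≤ ∑ _v : L, s' := by
      refine Finset.sum_le_sum fun v _ => ?_
      simp only [gate', CircuitGate.children_mapNodes, Multiset.card_map]
      exact (W v).size_le
    rw [Finset.sum_add_distrib, Finset.sum_boole] at h1
    simp only [Finset.filter_univ_mem, Nat.cast_id] at h1
    simp only [Finset.sum_const, Finset.card_univ, Fintype.card_coe, smul_eq_mul] at h2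
    have h3 : L.card * (s' + 1) ≤ (s + 1) * (s' + 1) := Nat.mul_le_mul_right _ hL
    have := K.size_le
    refine le_trans (add_le_add h1 h2) ?_
    linarith

end Circuits

/-! ### Size and degree bounds up to powers of one parameter -/

section Degree

theorem MvPolynomial.totalDegree_aeval_le_mul {R X Y : Type*} [CommSemiring R]
    (h : X → MvPolynomial Y R) {D : ℕ} (hh : ∀ x, (h x).totalDegree ≤ D) (f : MvPolynomial X R) :
    (aeval h f).totalDegree ≤ f.totalDegree * D := by
  rw [aeval_def, eval₂_eq]
  refine totalDegree_finsetSum_le fun m hm => ?_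
  rw [algebraMap_eq]
  refine (totalDegree_mul _ _).trans ?_
  rw [totalDegree_C, zero_add]
  refine (totalDegree_finsetProd _ _).trans ?_
  calc ∑ i ∈ m.support, (h i ^ m i).totalDegree
      ≤ ∑ i ∈ m.support, m i * D := Finset.sum_le_sum fun i _ =>
        (totalDegree_pow _ _).trans (Nat.mul_le_mul_left _ (hh i))
    _ = (∑ i ∈ m.support, m i) * D := (Finset.sum_mul ..).symm
    _ ≤ f.totalDegree * D := Nat.mul_le_mul_right _ (le_totalDegree hm)

/-- Evaluating a polynomial at univariate polynomials whose degrees are bounded by weights `w`. -/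
theorem MvPolynomial.natDegree_aeval_le {R S X : Type*} [CommSemiring R] [CommSemiring S]
    [Algebra R S] (h : X → Polynomial S) (w : X → ℕ) (hh : ∀ x, (h x).natDegree ≤ w x)
    (f : MvPolynomial X R) {N : ℕ} (hN : ∀ m ∈ f.support, ∑ i ∈ m.support, m i * w i ≤ N) :
    (aeval h f).natDegree ≤ N := by
  rw [aeval_def, eval₂_eq]
  refine Polynomial.natDegree_sum_le_of_forall_le _ _ fun m hm => ?_
  refine Polynomial.natDegree_mul_le.trans ?_
  rw [Polynomial.algebraMap_apply, Polynomial.natDegree_C, zero_add]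
  refine (Polynomial.natDegree_prod_le _ _).trans (le_trans ?_ (hN m hm))
  exact Finset.sum_le_sum fun i _ =>
    Polynomial.natDegree_pow_le.trans (Nat.mul_le_mul_left _ (hh i))

theorem MvPolynomial.natDegree_aeval_le_totalDegree {R S X : Type*} [CommSemiring R]
    [CommSemiring S] [Algebra R S] (h : X → Polynomial S) (hh : ∀ x, (h x).natDegree ≤ 1)
    (f : MvPolynomial X R) : (aeval h f).natDegree ≤ f.totalDegree :=
  natDegree_aeval_le h (fun _ => 1) hh f fun m hm => by
    simp only [mul_one]
    exact le_totalDegree hm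

end Degree

section Comp

variable {F : Type*} [Field F] {X Y : Type*} {M : ℕ}

/-- `f` has a circuit of depth at most `Δ` and size at most `M ^ a`, and total degree at most
`M ^ e`. Measuring sizes and degrees by exponents of one common parameter `M` makes polynomial
bounds compose additively. A polynomial is called cheap below if it satisfies such a bound with
`Δ` and the exponents under control. -/
def Comp (M Δ a e : ℕ) (f : MvPolynomial X F) : Prop :=
  ComputableBy f Δ ((M ^ a : ℕ) : ℝ) ∧ f.totalDegree ≤ M ^ e

theorem Comp.mono {Δ a e Δ' a' e' : ℕ} {f : MvPolynomial X F} (h : Comp M Δ a e f)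
    (hM : 2 ≤ M) (hΔ : Δ ≤ Δ') (ha : a ≤ a') (he : e ≤ e') : Comp M Δ' a' e' f :=
  ⟨h.1.mono hΔ (by exact_mod_cast Nat.pow_le_pow_right (by omega) ha),
    h.2.trans (Nat.pow_le_pow_right (by omega) he)⟩

theorem comp_C (c : F) (Δ a e : ℕ) : Comp M Δ a e (MvPolynomial.C c : MvPolynomial X F) :=
  ⟨computableBy_C c Δ _, by simp⟩

theorem comp_X (hM : 2 ≤ M) (x : X) (Δ a e : ℕ) :
    Comp M Δ a e (MvPolynomial.X x : MvPolynomial X F) :=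
  ⟨computableBy_X x Δ _, by rw [MvPolynomial.totalDegree_X]; exact Nat.one_le_pow _ _ (by omega)⟩

theorem pow_mul_succ_le (hM : 2 ≤ M) {n a b : ℕ} (hn : n ≤ M ^ b) :
    n * (M ^ a + 1) ≤ M ^ (a + b + 1) := by
  have h1 : M ^ a + 1 ≤ M ^ a * M := by
    have := Nat.one_le_pow a M (by omega)
    nlinarith
  calc n * (M ^ a + 1) ≤ M ^ b * (M ^ a * M) := Nat.mul_le_mul hn h1
    _ = M ^ (a + b + 1) := by ring

theorem Comp.sum (hM : 2 ≤ M) {ι : Type} (t : Finset ι) {f : ι → MvPolynomial X F}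
    {Δ a e b : ℕ} (hf : ∀ i ∈ t, Comp M Δ a e (f i)) (ht : t.card ≤ M ^ b) :
    Comp M (Δ + 1) (a + b + 1) e (∑ i ∈ t, f i) := by
  refine ⟨(computableBy_sum t fun i hi => (hf i hi).1).mono le_rfl ?_,
    MvPolynomial.totalDegree_finsetSum_le fun i hi => (hf i hi).2⟩
  exact_mod_cast pow_mul_succ_le hM ht

theorem Comp.prod (hM : 2 ≤ M) {ι : Type} (t : Finset ι) {f : ι → MvPolynomial X F}
    {Δ a e b : ℕ} (hf : ∀ i ∈ t, Comp M Δ a e (f i)) (ht : t.card ≤ M ^ b) :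
    Comp M (Δ + 1) (a + b + 1) (e + b) (∏ i ∈ t, f i) := by
  refine ⟨(computableBy_prod t fun i hi => (hf i hi).1).mono le_rfl ?_, ?_⟩
  · exact_mod_cast pow_mul_succ_le hM ht
  · refine (MvPolynomial.totalDegree_finsetProd _ _).trans ?_
    refine (Finset.sum_le_card_nsmul _ _ _ fun i hi => (hf i hi).2).trans ?_
    rw [smul_eq_mul, pow_add, mul_comm]
    exact Nat.mul_le_mul_left _ ht

theorem Comp.pow (hM : 2 ≤ M) {f : MvPolynomial X F} {Δ a e b n : ℕ} (hf : Comp M Δ a e f)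
    (hn : n ≤ M ^ b) : Comp M (Δ + 1) (a + b + 1) (e + b) (f ^ n) := by
  have := Comp.prod hM (Finset.range n) (f := fun _ => f) (fun _ _ => hf) (by simpa using hn)
  simpa using this

theorem Comp.mul (hM : 2 ≤ M) {f g : MvPolynomial X F} {Δ a e : ℕ} (hf : Comp M Δ a e f)
    (hg : Comp M Δ a e g) : Comp M (Δ + 1) (a + 2) (e + 1) (f * g) := by
  have := Comp.prod hM (Finset.univ : Finset (Fin 2)) (f := ![f, g]) (b := 1) (Δ := Δ) (a := a)
    (e := e) (by intro i _; fin_cases i; exacts [hf, hg]) (by simpa using hM)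
  simpa using this

theorem Comp.add (hM : 2 ≤ M) {f g : MvPolynomial X F} {Δ a e : ℕ} (hf : Comp M Δ a e f)
    (hg : Comp M Δ a e g) : Comp M (Δ + 1) (a + 2) e (f + g) := by
  have := Comp.sum hM (Finset.univ : Finset (Fin 2)) (f := ![f, g]) (b := 1) (Δ := Δ) (a := a)
    (e := e) (by intro i _; fin_cases i; exacts [hf, hg]) (by simpa using hM)
  simpa using this

theorem Comp.C_mul (hM : 2 ≤ M) {f : MvPolynomial X F} {Δ a e : ℕ} (hf : Comp M Δ a e f)
    (c : F) : Comp M (Δ + 1) (a + 2) e (MvPolynomial.C c * f) := by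
  refine ⟨(Comp.mul hM (comp_C c Δ a e) hf).1, (MvPolynomial.totalDegree_mul _ _).trans ?_⟩
  rw [MvPolynomial.totalDegree_C, zero_add]
  exact hf.2

/-- Linear combinations over the base field. -/
theorem Comp.lincomb (hM : 2 ≤ M) {ι : Type} (t : Finset ι) (c : ι → F)
    {f : ι → MvPolynomial X F} {Δ a e b : ℕ} (hf : ∀ i ∈ t, Comp M Δ a e (f i))
    (ht : t.card ≤ M ^ b) :
    Comp M (Δ + 2) (a + b + 3) e (∑ i ∈ t, MvPolynomial.C (c i) * f i) :=
  (Comp.sum hM t (fun i hi => (hf i hi).C_mul hM (c i)) ht).mono hM le_rfl (by omega) le_rfl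

theorem Comp.aeval (hM : 2 ≤ M) {f : MvPolynomial X F} {h : X → MvPolynomial Y F}
    {Δ a e Δ' a' e' : ℕ} (hf : Comp M Δ a e f) (hh : ∀ x, Comp M Δ' a' e' (h x)) :
    Comp M (Δ + Δ' + 1) (a + a' + 3) (e + e') (MvPolynomial.aeval h f) := by
  refine ⟨(hf.1.aeval fun x => (hh x).1).mono le_rfl ?_, ?_⟩
  · have h1 := Nat.one_le_pow a M (by omega)
    have h2 := Nat.one_le_pow a' M (by omega)
    have h4 : 4 ≤ M * M := Nat.mul_le_mul hM hM
    have h5 : 8 ≤ M * M * M := Nat.mul_le_mul h4 hM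
    have h6 : M ^ a + (M ^ a + 1) * (M ^ a' + 1) ≤ 8 * (M ^ a * M ^ a') := by nlinarith
    have h7 : 8 * (M ^ a * M ^ a') ≤ M * M * M * (M ^ a * M ^ a') := Nat.mul_le_mul_right _ h5
    have h8 : M * M * M * (M ^ a * M ^ a') = M ^ (a + a' + 3) := by ring
    exact_mod_cast (h6.trans h7).trans h8.le
  · rw [pow_add]
    exact (MvPolynomial.totalDegree_aeval_le_mul h (fun x => (hh x).2) f).trans
      (Nat.mul_le_mul_right _ hf.2)

end Comp

/-! ### Interpolation -/

section Interpolation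

/-- Over a field of characteristic zero, a linear functional of the coefficients of a polynomial of
degree less than `N` is a linear combination of its values at `N` constants. -/
theorem Polynomial.exists_interpolation (F : Type*) [Field F] [CharZero F] (N : ℕ) (c : ℕ → F) :
    ∃ l : ℕ → F, ∀ (R : Type*) [CommRing R] [Algebra F R] (p : Polynomial R), p.natDegree < N →
      ∑ j ∈ Finset.range N, algebraMap F R (c j) * p.coeff j =
        ∑ i ∈ Finset.range N, algebraMap F R (l i) * p.eval (algebraMap F R i) := by
  classical
  let v : Fin N → F := fun i => ((i : ℕ) : F)
  have hv : Function.Injective v := fun i j h => Fin.ext (Nat.cast_injective h)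
  have hdet : IsUnit (Matrix.vandermonde v).det :=
    (Matrix.det_vandermonde_ne_zero_iff.2 hv).isUnit
  let w : Fin N → F := Matrix.vecMul (fun j : Fin N => c j) (Matrix.vandermonde v)⁻¹
  have hw : Matrix.vecMul w (Matrix.vandermonde v) = fun j : Fin N => c j := by
    rw [Matrix.vecMul_vecMul, Matrix.nonsing_inv_mul _ hdet, Matrix.vecMul_one]
  refine ⟨fun i => if h : i < N then w ⟨i, h⟩ else 0, fun R _ _ p hp => ?_⟩
  rw [Finset.sum_range, Finset.sum_range]
  have h1 : ∀ j : Fin N, c j = ∑ i, w i * ((i : ℕ) : F) ^ (j : ℕ) := fun j =>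
    (congrFun hw j).symm
  simp only [h1, Fin.is_lt, dite_true, Fin.eta, Polynomial.eval_eq_sum_range' hp, map_sum, map_mul,
    map_pow, Finset.sum_mul, Finset.mul_sum]
  rw [Finset.sum_comm]
  refine Finset.sum_congr rfl fun i _ => ?_
  rw [Finset.sum_range]
  exact Finset.sum_congr rfl fun j _ => by ring

variable {F : Type*} [Field F] [CharZero F] {X : Type*} {M : ℕ}

/-- A linear functional of the coefficients of `p` is cheap if all values of `p` at constants
are. -/
theorem Comp.of_eval (hM : 2 ≤ M) {p : Polynomial (MvPolynomial X F)} {Δ a e b : ℕ}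
    (hp : ∀ x : F, Comp M Δ a e (p.eval (MvPolynomial.C x))) (hb : p.natDegree < M ^ b)
    (c : ℕ → F) :
    Comp M (Δ + 2) (a + b + 3) e
      (∑ j ∈ Finset.range (M ^ b), MvPolynomial.C (c j) * p.coeff j) := by
  obtain ⟨l, hl⟩ := Polynomial.exists_interpolation F (M ^ b) c
  have := hl (MvPolynomial X F) p hb
  rw [MvPolynomial.algebraMap_eq] at this
  rw [this]
  exact Comp.lincomb hM _ _ (fun i _ => hp i) (by simp)

theorem Comp.coeff (hM : 2 ≤ M) {p : Polynomial (MvPolynomial X F)} {Δ a e b : ℕ}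
    (hp : ∀ x : F, Comp M Δ a e (p.eval (MvPolynomial.C x))) (hb : p.natDegree < M ^ b) (j : ℕ) :
    Comp M (Δ + 2) (a + b + 3) e (p.coeff j) := by
  by_cases hj : j < M ^ b
  · have := Comp.of_eval hM hp hb fun i => if i = j then 1 else 0
    simpa [apply_ite, ite_mul, hj] using this
  · rw [Polynomial.coeff_eq_zero_of_natDegree_lt (by omega), ← MvPolynomial.C_0]
    exact comp_C 0 _ _ _

end Interpolation

/-! ### Truncated Lagrange inversion -/

section Inversion

open Polynomial

theorem Finset.sum_range_succ_mul_sub {R : Type*} [CommRing R] (β : ℕ → R) (n : ℕ) :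
    ∑ j ∈ Finset.range n, ((j + 1 : R) * β j - (j + 1) * β (j + 1)) =
      ∑ j ∈ Finset.range n, β j - n * β n := by
  induction n with
  | zero => simp
  | succ n ih => rw [Finset.sum_range_succ, ih, Finset.sum_range_succ]; push_cast; ring

/-- A fixed point `φ ∈ (t)` of `H` is `∑ m ≥ 1, (1 / m) * [z ^ (m - 1)] H ^ m`, when `t` is nilpotent
and divides the two lowest coefficients of `H`. The sum is a residue: it is the coefficient of
`z ^ (N - 2)` in `(1 - H') * (z ^ N - H ^ N) / (z - H)`, and the factorization
`z - H = (z - φ) * u` with `u` invertible modulo `z ^ N` allows to compute it. -/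
theorem Polynomial.eq_sum_of_isFixedPt_of_pow_eq_zero {F R : Type*} [Field F] [CharZero F]
    [CommRing R] [Algebra F R] {t φ : R} {k : ℕ} (ht : t ^ k = 0) {H : R[X]}
    (h0 : t ∣ H.coeff 0) (h1 : t ∣ H.coeff 1) (hφ : t ∣ φ) (hfix : H.eval φ = φ) :
    φ = ∑ j ∈ Finset.range (2 * k + 1),
      algebraMap F R ((j : F) + 1)⁻¹ * (H ^ (j + 1)).coeff j := by
  obtain ⟨a0, h0⟩ := h0
  obtain ⟨a1, h1⟩ := h1
  obtain ⟨f, hf⟩ := hφ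
  -- `N` is large enough for `H ^ (N - 1)`, which lies in `(t, z ^ 2) ^ (N - 1)`, to be divisible
  -- by `z ^ N`
  set N := 2 * k + 2 with hN
  set H2 := H.divX.divX with hH2
  have hH : H = C (t * a0) + C (t * a1) * X + X ^ 2 * H2 := by
    have e1 := X_mul_divX_add H
    have e2 := X_mul_divX_add H.divX
    rw [coeff_divX, zero_add, h1] at e2
    rw [h0] at e1
    linear_combination -e1 - X * e2
  -- `(t, z ^ r) ^ (k + m)` is contained in `(z ^ (r * m))`
  have hpow : ∀ r m : ℕ, ∀ p ∈ (Ideal.span {C t} ⊔ Ideal.span {(X : R[X]) ^ r}) ^ (k + m),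
      (X : R[X]) ^ (r * m) ∣ p := by
    intro r m p hp
    have := Ideal.sup_pow_add_le_pow_sup_pow hp
    rwa [Ideal.span_singleton_pow, Ideal.span_singleton_pow, ← C_pow, ht, C_0,
      Ideal.span_singleton_zero, bot_sup_eq, ← pow_mul, Ideal.mem_span_singleton] at this
  set J := Ideal.span {C t} ⊔ Ideal.span {(X : R[X]) ^ 2} with hJ
  have hCt : ∀ (r : ℕ) (b : R[X]), C t * b ∈ Ideal.span {C t} ⊔ Ideal.span {(X : R[X]) ^ r} :=
    fun r b => Ideal.mem_sup_left (Ideal.mem_span_singleton.2 (Dvd.intro _ rfl))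
  have hXr : ∀ (r : ℕ) (b : R[X]), X ^ r * b ∈ Ideal.span {C t} ⊔ Ideal.span {(X : R[X]) ^ r} :=
    fun r b => Ideal.mem_sup_right (Ideal.mem_span_singleton.2 (Dvd.intro _ rfl))
  have hHJ : H ∈ J := by
    rw [hH]
    refine add_mem (add_mem ?_ ?_) (hXr 2 _)
    · rw [C_mul]; exact hCt 2 _
    · rw [C_mul, mul_assoc]; exact hCt 2 _
  have hφJ : C φ ∈ J := by rw [hf, C_mul]; exact hCt 2 _
  have hHN : (X : R[X]) ^ N ∣ H ^ N := by
    have := hpow 2 (k + 1) (H ^ (N - 1)) (by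
      rw [show N - 1 = k + (k + 1) by omega]; exact Ideal.pow_mem_pow hHJ _)
    rw [show 2 * (k + 1) = N by omega] at this
    exact this.trans (pow_dvd_pow _ (by omega))
  -- the factorization `z - H = (z - φ) * (1 - v)`
  obtain ⟨w, hw⟩ := X_sub_C_dvd_sub_C_eval (p := H2) (a := φ)
  set v := C (t * a1) + X ^ 2 * w + (X + C φ) * C (H2.eval φ) with hv
  have hfix' : C φ = C (t * a0) + C (t * a1) * C φ + C φ ^ 2 * C (H2.eval φ) := by
    conv_lhs => rw [← hfix, hH]
    simp
  have hHv : H - C φ = (X - C φ) * v := by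
    rw [hv]
    linear_combination hH - hfix' + X ^ 2 * hw
  have hvJ : v ∈ Ideal.span {C t} ⊔ Ideal.span {(X : R[X]) ^ 1} := by
    rw [hv]
    refine add_mem (add_mem ?_ ?_) ?_
    · rw [C_mul]; exact hCt 1 _
    · rw [show X ^ 2 * w = X ^ 1 * (X * w) by ring]; exact hXr 1 _
    · rw [add_mul, hf, C_mul, mul_assoc]
      refine add_mem ?_ (hCt 1 _)
      simpa using hXr 1 (C (H2.eval (t * f)))
  -- `v` is nilpotent modulo `z ^ N`, so `1 - v` is invertible there
  have hvN : (X : R[X]) ^ N ∣ v ^ (k + N) := by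
    simpa using hpow 1 N _ (Ideal.pow_mem_pow hvJ _)
  set G := ∑ m ∈ Finset.range N, H ^ m * X ^ (N - 1 - m) with hG
  have hGH : G * (H - X) = H ^ N - X ^ N := (Commute.all H X).geom_sum₂_mul N
  have hE : (X : R[X]) ^ N ∣ (X - C φ) * G := by
    have e1 : (1 - v) * ((X - C φ) * G) = X ^ N - H ^ N := by
      linear_combination G * hHv - hGH
    have e2 : (X : R[X]) ^ N ∣ (∑ i ∈ Finset.range (k + N), v ^ i) * (X ^ N - H ^ N) :=
      Dvd.dvd.mul_left (dvd_sub dvd_rfl hHN) _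
    rw [← e1, ← mul_assoc, mul_comm (∑ i ∈ _, _), mul_neg_geom_sum, sub_mul, one_mul] at e2
    exact (dvd_sub_left (hvN.mul_right _)).1 e2
  set S := ∑ m ∈ Finset.range N, (X : R[X]) ^ m * C φ ^ (N - 1 - m) with hS
  have hSX : S * (X - C φ) = X ^ N - C φ ^ N := (Commute.all X (C φ)).geom_sum₂_mul N
  set K := ∑ m ∈ Finset.range N, H ^ m * C φ ^ (N - 1 - m) with hK
  have hKX : K * (H - C φ) = H ^ N - C φ ^ N := (Commute.all H (C φ)).geom_sum₂_mul N
  have hKN : (X : R[X]) ^ N ∣ K := by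
    refine Finset.dvd_sum fun m hm => ?_
    have : H ^ m * C φ ^ (N - 1 - m) ∈ J ^ (k + (k + 1)) := by
      have := Ideal.mul_mem_mul (Ideal.pow_mem_pow hHJ m) (Ideal.pow_mem_pow hφJ (N - 1 - m))
      rw [Finset.mem_range] at hm
      rwa [← pow_add, show m + (N - 1 - m) = k + (k + 1) by omega] at this
    exact hpow 2 (k + 1) _ this
  have huG : (1 - v) * G = S - v * K := by
    refine (monic_X_sub_C φ).isRegular.left ?_
    change (X - C φ) * _ = (X - C φ) * _
    linear_combination (G - K) * hHv - hGH - hSX + hKX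
  have hmain : (1 - derivative H) * G =
      S - v * K - derivative v * ((X - C φ) * G) := by
    have e := congrArg derivative hHv
    simp only [derivative_sub, derivative_mul, derivative_C, derivative_X, sub_zero] at e
    linear_combination huG - G * e
  have hcoef : ((1 - derivative H) * G).coeff (N - 2) = φ := by
    have hz : ∀ p : R[X], X ^ N ∣ p → p.coeff (N - 2) = 0 := fun p hp =>
      X_pow_dvd_iff.1 hp _ (by omega)
    rw [hmain, coeff_sub, coeff_sub, hz _ (hKN.mul_left _), hz _ (hE.mul_left _), hS,
      finsetSum_coeff, Finset.sum_eq_single (N - 2)]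
    · rw [show N - 1 - (N - 2) = 1 by omega]
      simp
    · intro m _ hm
      rw [← C_pow, coeff_mul_C, coeff_X_pow, if_neg (Ne.symm hm), zero_mul]
    · intro h
      exact absurd (Finset.mem_range.2 (by omega)) h
  -- since `H' * H ^ m = (H ^ (m + 1))' / (m + 1)`, the terms with `H'` telescope
  let β : ℕ → R := fun j => algebraMap F R ((j : F) + 1)⁻¹ * (H ^ (j + 1)).coeff j
  have hβ : ∀ j, (H ^ (j + 1)).coeff j = (j + 1) * β j := by
    intro j
    have : (j + 1 : R) = algebraMap F R ((j : F) + 1) := by simp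
    rw [this, ← mul_assoc, ← map_mul, mul_inv_cancel₀ (Nat.cast_add_one_ne_zero j), map_one,
      one_mul]
  have hβ' : ∀ j, (derivative H * H ^ (j + 1)).coeff j = (j + 1) * β (j + 1) := by
    intro j
    have e1 := congrArg (fun p => coeff p j) (derivative_pow_succ H (j + 1))
    simp only [coeff_derivative, mul_assoc, coeff_C_mul] at e1
    rw [hβ (j + 1), mul_comm (H ^ (j + 1))] at e1
    have e2 : IsUnit ((j + 1 : ℕ) + 1 : R) := by
      have : ((j + 1 : ℕ) + 1 : R) = algebraMap F R (((j + 1 : ℕ) : F) + 1) := by simp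
      rw [this]
      exact (IsUnit.mk0 _ (Nat.cast_add_one_ne_zero _)).map _
    refine e2.mul_left_cancel ?_
    linear_combination -e1
  have hβN : β (2 * k + 1) = 0 := by
    have : (H ^ (2 * k + 1 + 1)).coeff (2 * k + 1) = 0 := X_pow_dvd_iff.1 hHN _ (by omega)
    simp only [β, this, mul_zero]
  have htel := Finset.sum_range_succ_mul_sub β (2 * k + 1)
  rw [hβN, mul_zero, sub_zero] at htel
  rw [← htel]
  conv_lhs => rw [← hcoef]
  rw [hG, Finset.mul_sum, finsetSum_coeff, show N = 2 * k + 1 + 1 by omega,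
    Finset.sum_range_succ']
  have hlast : ((1 - derivative H) * (H ^ 0 * X ^ (2 * k + 1 + 1 - 1 - 0))).coeff
      (2 * k + 1 + 1 - 2) = 0 := by
    rw [pow_zero, one_mul, coeff_mul_X_pow', if_neg (by omega)]
  rw [hlast, add_zero]
  refine Finset.sum_congr rfl fun j hj => ?_
  rw [Finset.mem_range] at hj
  rw [← mul_assoc, coeff_mul_X_pow', if_pos (by omega),
    show 2 * k + 1 + 1 - 2 - (2 * k + 1 + 1 - 1 - (j + 1)) = j by omega, sub_mul, one_mul, coeff_sub,
    hβ, hβ']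

/-- The approximate form of the inversion formula, modulo `t ^ k`. -/
theorem Polynomial.pow_dvd_sub_sum_of_pow_dvd {F R : Type*} [Field F] [CharZero F]
    [CommRing R] [Algebra F R] {t φ : R} {k : ℕ} {H : R[X]}
    (h0 : t ∣ H.coeff 0) (h1 : t ∣ H.coeff 1) (hφ : t ∣ φ) (hfix : t ^ k ∣ H.eval φ - φ) :
    t ^ k ∣ φ - ∑ j ∈ Finset.range (2 * k + 1),
      algebraMap F R ((j : F) + 1)⁻¹ * (H ^ (j + 1)).coeff j := by
  let π := Ideal.Quotient.mk (Ideal.span {t ^ k})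
  have hπ : ∀ x, π x = 0 ↔ t ^ k ∣ x := fun x => by
    rw [Ideal.Quotient.eq_zero_iff_mem, Ideal.mem_span_singleton]
  have := Polynomial.eq_sum_of_isFixedPt_of_pow_eq_zero (F := F) (t := π t) (φ := π φ) (k := k)
    (H := H.map π) (by rw [← map_pow, hπ]) (by rw [coeff_map]; exact _root_.map_dvd π h0)
    (by rw [coeff_map]; exact _root_.map_dvd π h1) (_root_.map_dvd π hφ)
    (by rw [eval_map_apply, ← sub_eq_zero, ← map_sub, hπ]; exact hfix)
  rw [← hπ, map_sub, sub_eq_zero, map_sum, this]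
  refine Finset.sum_congr rfl fun j _ => ?_
  rw [map_mul, ← Polynomial.map_pow, coeff_map]
  rfl

end Inversion

/-! ### Circuits for approximate roots -/

section ApproxRoot

open Polynomial

section CoeffDegree

variable {R : Type*} [CommRing R]

theorem natDegree_coeff_mul_le {p q : R[X][X]} {m n : ℕ} (hp : ∀ i, (p.coeff i).natDegree ≤ m)
    (hq : ∀ i, (q.coeff i).natDegree ≤ n) (i : ℕ) : ((p * q).coeff i).natDegree ≤ m + n := by
  rw [coeff_mul]
  refine natDegree_sum_le_of_forall_le _ _ fun x _ => ?_
  exact natDegree_mul_le.trans (add_le_add (hp _) (hq _))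

theorem natDegree_coeff_C_le {a : R[X]} {n : ℕ} (ha : a.natDegree ≤ n) (i : ℕ) :
    ((C a : R[X][X]).coeff i).natDegree ≤ n := by
  rw [coeff_C]
  split_ifs
  · exact ha
  · simp

theorem natDegree_coeff_prod_le {ι : Type*} (t : Finset ι) {p : ι → R[X][X]} {n : ι → ℕ}
    (hp : ∀ j ∈ t, ∀ i, ((p j).coeff i).natDegree ≤ n j) (i : ℕ) :
    ((∏ j ∈ t, p j).coeff i).natDegree ≤ ∑ j ∈ t, n j := by
  induction t using Finset.cons_induction generalizing i with
  | empty =>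
    rw [Finset.prod_empty, ← C_1]
    exact natDegree_coeff_C_le (by simp) i
  | cons a t ha ih =>
    rw [Finset.prod_cons, Finset.sum_cons]
    exact natDegree_coeff_mul_le (hp a (Finset.mem_cons_self a t))
      (ih fun j hj => hp j (Finset.mem_cons_of_mem hj)) i

theorem natDegree_coeff_pow_le {p : R[X][X]} {n : ℕ} (hp : ∀ i, (p.coeff i).natDegree ≤ n)
    (m i : ℕ) : ((p ^ m).coeff i).natDegree ≤ m * n := by
  have := natDegree_coeff_prod_le (Finset.range m) (p := fun _ => p) (fun _ _ => hp) i
  simpa using this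

theorem natDegree_coeff_X_le (i : ℕ) : ((X : R[X][X]).coeff i).natDegree ≤ 0 := by
  rw [coeff_X]
  split_ifs <;> simp

theorem natDegree_coeff_comp_X_add_C_le {p : R[X][X]} {n : ℕ}
    (hp : ∀ i, (p.coeff i).natDegree ≤ n) (r : R) (i : ℕ) :
    ((p.comp (X + C (C r))).coeff i).natDegree ≤ n := by
  rw [comp_eq_sum_left, Polynomial.sum_def, finsetSum_coeff]
  refine natDegree_sum_le_of_forall_le _ _ fun j _ => ?_
  have h : ∀ i, ((X + C (C r) : R[X][X]).coeff i).natDegree ≤ 0 := fun i => by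
    rw [coeff_add]
    exact (natDegree_add_le _ _).trans (max_le (natDegree_coeff_X_le i)
      (natDegree_coeff_C_le (by simp) i))
  have := natDegree_coeff_mul_le (natDegree_coeff_C_le (hp j)) (natDegree_coeff_pow_le h j) i
  simpa using this

end CoeffDegree

variable {F : Type*} [Field F] [CharZero F] {X₀ : Type*} {M : ℕ}

/-- A truncated approximate root `φ` of `A` has cheap coefficients if the values of `A` at all
constants `T = y`, `z = x` are cheap: the coefficients of `φ` are explicit linear combinations of
coefficients of powers of `z - A(T, z + α) / A'(α)`, which are found by interpolation. -/
theorem Comp.coeff_of_approxRoot (hM : 2 ≤ M) {A : (MvPolynomial X₀ F)[X][X]}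
    {φ : (MvPolynomial X₀ F)[X]} {α ε : F} {k Δ a b e : ℕ} (hk : 0 < k) (hkM : k ≤ M)
    (hφk : φ.natDegree < k) (hroot : X ^ k ∣ A.eval φ)
    (hφ0 : φ.coeff 0 = MvPolynomial.C α) (hε : ε ≠ 0)
    (hder : ((derivative A).eval (C (MvPolynomial.C α))).coeff 0 = MvPolynomial.C ε)
    (hz : A.natDegree ≤ M ^ b) (hT : ∀ i, (A.coeff i).natDegree ≤ M ^ b)
    (hA : ∀ x y : F,
      Comp M Δ a e ((A.eval (C (MvPolynomial.C x))).eval (MvPolynomial.C y))) (j : ℕ) :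
    Comp M (Δ + 10) (a + 2 * b + 30) (e + 3) (φ.coeff j) := by
  let κ : F → (MvPolynomial X₀ F)[X] := fun x => C (MvPolynomial.C x)
  have hκ : ∀ x, algebraMap F (MvPolynomial X₀ F)[X] x = C (MvPolynomial.C x) := fun x => by
    rw [Polynomial.algebraMap_apply, MvPolynomial.algebraMap_eq]
  set B := A.comp (X + C (κ α)) with hB
  set H : (MvPolynomial X₀ F)[X][X] := X + C (κ (-ε⁻¹)) * B with hH
  have hXφ : X ∣ φ - κ α := by
    rw [X_dvd_iff, coeff_sub, coeff_C_zero, hφ0, sub_self]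
  have hevalH : ∀ p, H.eval p = p + κ (-ε⁻¹) * A.eval (p + κ α) := fun p => by
    simp [hH, hB, eval_comp]
  have h0 : X ∣ H.coeff 0 := by
    rw [coeff_zero_eq_eval_zero, hevalH, zero_add, zero_add]
    refine Dvd.dvd.mul_left ?_ _
    have h1 : X ∣ A.eval φ := (dvd_pow_self X hk.ne').trans hroot
    have h2 : X ∣ A.eval φ - A.eval (κ α) := hXφ.trans (sub_dvd_eval_sub _ _ _)
    exact (dvd_sub_right h1).1 h2
  have h1 : X ∣ H.coeff 1 := by
    have h2 : (derivative B).coeff 0 = B.coeff 1 := by rw [coeff_derivative]; simp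
    have h3 : (derivative B).coeff 0 = (derivative A).eval (κ α) := by
      rw [coeff_zero_eq_eval_zero, hB, derivative_comp]
      simp [eval_comp]
    rw [X_dvd_iff, hH, coeff_add, coeff_C_mul, coeff_X_one, ← h2, h3, coeff_add, mul_coeff_zero,
      hder, coeff_C_zero, ← MvPolynomial.C_mul, coeff_one_zero, ← MvPolynomial.C_1,
      ← MvPolynomial.C_add]
    rw [neg_mul, inv_mul_cancel₀ hε, add_neg_cancel, MvPolynomial.C_0]
  have hfix : X ^ k ∣ H.eval (φ - κ α) - (φ - κ α) := by
    rw [hevalH, sub_add_cancel, add_sub_cancel_left]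
    exact hroot.mul_left _
  have hmain := pow_dvd_sub_sum_of_pow_dvd (F := F) h0 h1 hXφ hfix
  by_cases hj : k ≤ j
  · rw [coeff_eq_zero_of_natDegree_lt (by omega), ← MvPolynomial.C_0]
    exact comp_C 0 _ _ _
  have hcoef := X_pow_dvd_iff.1 hmain j (by omega)
  rw [coeff_sub, sub_eq_zero, coeff_sub, sub_eq_iff_eq_add, finsetSum_coeff] at hcoef
  simp only [hκ, coeff_C_mul] at hcoef
  rw [hcoef]
  -- degrees of `H` in `z` and in `T`
  have hM1 : 1 ≤ M ^ b := Nat.one_le_pow _ _ (by omega)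
  have hHz : H.natDegree ≤ M ^ b := by
    refine (natDegree_add_le _ _).trans (max_le ((natDegree_X_le).trans hM1) ?_)
    refine (natDegree_C_mul_le _ _).trans ?_
    rw [hB]
    refine natDegree_comp_le.trans ?_
    rw [natDegree_X_add_C, mul_one]
    exact hz
  have hHT : ∀ i, (H.coeff i).natDegree ≤ M ^ b := fun i => by
    rw [hH, coeff_add, coeff_C_mul]
    refine (natDegree_add_le _ _).trans (max_le ((natDegree_coeff_X_le i).trans (Nat.zero_le _)) ?_)
    exact (natDegree_C_mul_le _ _).trans (natDegree_coeff_comp_X_add_C_le hT _ i)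
  have hkM3 : 2 * k + 1 ≤ M ^ 3 := by
    have : 4 ≤ M * M := Nat.mul_le_mul hM hM
    calc 2 * k + 1 ≤ 4 * M := by omega
      _ ≤ M * M * M := Nat.mul_le_mul_right _ this
      _ = M ^ 3 := by ring
  have hbig : ∀ i < 2 * k + 1, (i + 1) * M ^ b < M ^ (b + 4) := fun i hi => by
    calc (i + 1) * M ^ b ≤ M ^ 3 * M ^ b := Nat.mul_le_mul_right _ (by omega)
      _ = M ^ (b + 3) := by ring
      _ < M ^ (b + 4) := Nat.pow_lt_pow_right (by omega) (by omega)
  have hterm : ∀ i ∈ Finset.range (2 * k + 1),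
      Comp M (Δ + 7) (a + 2 * b + 22) (e + 3) (((H ^ (i + 1)).coeff i).coeff j) := by
    intro i hi
    rw [Finset.mem_range] at hi
    have hT' : ((H ^ (i + 1)).coeff i).natDegree < M ^ (b + 4) :=
      (natDegree_coeff_pow_le hHT _ _).trans_lt (hbig i hi)
    refine (Comp.coeff hM (Δ := Δ + 5) (a := a + b + 15) (e := e + 3) (fun y => ?_) hT' j).mono hM
      le_rfl (by omega) le_rfl
    let ev := evalRingHom (MvPolynomial.C y : MvPolynomial X₀ F)
    have h2 : ((H ^ (i + 1)).coeff i).eval (MvPolynomial.C y) = ((H.map ev) ^ (i + 1)).coeff i := by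
      rw [← Polynomial.map_pow, coeff_map]; rfl
    rw [h2]
    have hz' : ((H.map ev) ^ (i + 1)).natDegree < M ^ (b + 4) := by
      refine natDegree_pow_le.trans_lt (lt_of_le_of_lt ?_ (hbig i hi))
      exact Nat.mul_le_mul_left _ (natDegree_map_le.trans hHz)
    refine (Comp.coeff hM (Δ := Δ + 3) (a := a + 8) (e := e + 3) (fun x => ?_) hz' i).mono hM
      le_rfl (by omega) le_rfl
    rw [eval_pow]
    refine (Comp.pow hM (Δ := Δ + 2) (a := a + 4) (e := e) (b := 3) ?_ (by omega)).mono hM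
      le_rfl le_rfl le_rfl
    have h3 : (H.map ev).eval (MvPolynomial.C x) = MvPolynomial.C x + MvPolynomial.C (-ε⁻¹) *
        (A.eval (C (MvPolynomial.C (x + α)))).eval (MvPolynomial.C y) := by
      have h4 : (MvPolynomial.C x : MvPolynomial X₀ F) = ev (κ x) := by simp [ev, κ]
      have h5 : κ x + κ α = C (MvPolynomial.C (x + α)) := by simp [κ]
      rw [h4, eval_map_apply, hevalH, h5, map_add, map_mul]
      simp [ev, κ]
    rw [h3]
    exact (Comp.add hM (comp_C x _ _ _) ((hA (x + α) y).C_mul hM (-ε⁻¹))).mono hM le_rfl le_rfl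
      le_rfl
  refine (Comp.add hM (Δ := Δ + 9) (a := a + 2 * b + 28) (e := e + 3) ?_ ?_).mono hM le_rfl le_rfl
    le_rfl
  · exact (Comp.lincomb hM _ _ hterm (b := 3) (by simpa using hkM3)).mono hM le_rfl (by omega)
      le_rfl
  · rw [coeff_C]
    split_ifs
    · exact comp_C _ _ _ _
    · rw [← MvPolynomial.C_0]
      exact comp_C _ _ _ _

end ApproxRoot

/-! ### Algebraic elements and sparse polynomials -/

section Sparse

/-- Over an infinite field, the base field is algebraically closed in a polynomial ring. -/
theorem MvPolynomial.exists_eq_C_of_eval_map_eq_zero {F X : Type*} [Field F] [Infinite F]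
    {p : Polynomial F} (hp : p ≠ 0) {f : MvPolynomial X F}
    (hf : (p.map (C : F →+* MvPolynomial X F)).eval f = 0) : ∃ c, f = C c := by
  classical
  -- at every point `f` takes one of the finitely many roots of `p` as its value
  have hprod : ∏ r ∈ p.roots.toFinset, (f - C r) = 0 := by
    refine MvPolynomial.funext fun b => ?_
    have h1 : p.eval (eval b f) = 0 := by
      have := congrArg (eval b) hf
      rw [← Polynomial.eval_map_apply, Polynomial.map_map,
        show (eval b).comp (C : F →+* MvPolynomial X F) = RingHom.id F by ext; simp,
        Polynomial.map_id, map_zero] at this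
      exact this
    rw [map_prod, map_zero]
    refine Finset.prod_eq_zero (i := eval b f) ?_ (by simp)
    simpa [hp] using h1
  obtain ⟨r, -, hr⟩ := Finset.prod_eq_zero_iff.1 hprod
  exact ⟨r, sub_eq_zero.1 hr⟩

/-- There are at most `(|V| + 1) ^ d` monomials of degree at most `d` in the variables `V`. -/
theorem exists_finset_monomials {Y : Type*} (V : Finset Y) (d : ℕ) :
    ∃ S : Finset (Y →₀ ℕ), S.card ≤ (V.card + 1) ^ d ∧
      ∀ m : Y →₀ ℕ, m.support ⊆ V → m.degree ≤ d → m ∈ S := by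
  classical
  induction d with
  | zero =>
    refine ⟨{0}, by simp, fun m _ hd => ?_⟩
    rw [Finset.mem_singleton, ← Finsupp.degree_eq_zero_iff]
    omega
  | succ d ih =>
    obtain ⟨S, hS, hmem⟩ := ih
    refine ⟨(V.insertNone ×ˢ S).image fun p => p.2 + p.1.elim 0 fun i => Finsupp.single i 1,
      ?_, fun m hV hd => ?_⟩
    · refine Finset.card_image_le.trans ?_
      rw [Finset.card_product, Finset.card_insertNone, pow_succ, mul_comm]
      exact Nat.mul_le_mul_right _ hS
    · rw [Finset.mem_image]
      by_cases h : m.degree ≤ d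
      · exact ⟨(none, m), by simp [hmem m hV h], by simp⟩
      · have h0 : m ≠ 0 := by
          rintro rfl
          simp at h
        obtain ⟨i, hi⟩ := Finsupp.support_nonempty_iff.2 h0
        have hle : Finsupp.single i 1 ≤ m := by
          rw [Finsupp.single_le_iff]
          exact Nat.one_le_iff_ne_zero.2 (Finsupp.mem_support_iff.1 hi)
        have hadd : m - Finsupp.single i 1 + Finsupp.single i 1 = m := tsub_add_cancel_of_le hle
        refine ⟨(some i, m - Finsupp.single i 1), ?_, hadd⟩
        rw [Finset.mem_product]
        refine ⟨by simpa using hV hi, hmem _ (Finsupp.support_tsub.trans hV) ?_⟩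
        have := congrArg Finsupp.degree hadd
        rw [map_add, Finsupp.degree_single] at this
        simp only at *
        omega

variable {F : Type*} [Field F] {Y : Type} {M : ℕ}

/-- Low-degree polynomials in few variables are cheap, being sums of few monomials. -/
theorem comp_of_card_vars_le (hM : 2 ≤ M) {f : MvPolynomial Y F} {d r : ℕ}
    (hd : f.totalDegree ≤ d) (hr : f.vars.card ≤ r) (hdM : d ≤ M) (hrM : (r + 1) ^ d ≤ M) :
    Comp M 4 8 1 f := by
  classical
  refine ⟨?_, by rw [pow_one]; exact hd.trans hdM⟩
  have hdeg : ∀ m ∈ f.support, ∑ i ∈ m.support, m i ≤ d := fun m hm =>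
    (MvPolynomial.le_totalDegree hm).trans hd
  have hcard : f.support.card ≤ M ^ 1 := by
    obtain ⟨S, hS, hmem⟩ := exists_finset_monomials f.vars d
    rw [pow_one]
    refine le_trans (Finset.card_le_card fun m hm => hmem m ?_ (hdeg m hm)) (hS.trans ?_)
    · intro i hi
      exact (MvPolynomial.mem_vars_iff_mem_support i).2 ⟨m, hm, hi⟩
    · exact (Nat.pow_le_pow_left (Nat.succ_le_succ hr) d).trans hrM
  have hsum : f = ∑ m ∈ f.support, MvPolynomial.C (f.coeff m) *
      ∏ i ∈ m.support, MvPolynomial.X i ^ m i := by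
    conv_lhs => rw [f.as_sum]
    refine Finset.sum_congr rfl fun m _ => ?_
    rw [MvPolynomial.monomial_eq]
    rfl
  rw [hsum]
  refine (Comp.lincomb (Δ := 2) (a := 4) (e := 2) hM _ _ (fun m hm => ?_) hcard).1
  have hcard' : m.support.card ≤ M ^ 1 := by
    rw [pow_one]
    refine le_trans ?_ ((hdeg m hm).trans hdM)
    rw [Finset.card_eq_sum_ones]
    exact Finset.sum_le_sum fun i hi => Nat.one_le_iff_ne_zero.2 (Finsupp.mem_support_iff.1 hi)
  refine Comp.prod hM (Δ := 1) (a := 2) (e := 1) _ (fun i hi => ?_) hcard'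
  refine Comp.pow hM (b := 1) (comp_X hM i 0 0 0) ?_
  rw [pow_one]
  exact (Finset.single_le_sum (fun _ _ => Nat.zero_le _) hi).trans ((hdeg m hm).trans hdM)

end Sparse

/-! ### The hybrid argument for the Kabanets–Impagliazzo generator -/

section Hybrid

variable {F : Type*} [Field F] {n σ μ ρ : ℕ}

theorem eval_eval_aeval {X Y : Type*} (u : X → Polynomial (MvPolynomial Y F)) (c : Y → F)
    (p : MvPolynomial Y F) (q : MvPolynomial X F) :
    MvPolynomial.eval c ((MvPolynomial.aeval u q).eval p) =
      MvPolynomial.eval (fun i => MvPolynomial.eval c ((u i).eval p)) q := by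
  have h := MvPolynomial.map_aeval u ((MvPolynomial.eval c).comp (Polynomial.evalRingHom p)) q
  have h2 : ((MvPolynomial.eval c).comp (Polynomial.evalRingHom p)).comp
      (algebraMap F (Polynomial (MvPolynomial Y F))) = RingHom.id F := by
    ext x
    simp [Polynomial.algebraMap_apply]
  rw [h2] at h
  exact h

open scoped Classical in
/-- If `q` is nonzero but vanishes on the generator, then replacing the inputs of `q` one at a time
by the generator's outputs there is a first replacement that kills `q`. Fixing all variables not
involved in it makes `g` a root of a nonzero univariate polynomial `q(u)`, where `u` consists of one
free variable and of restrictions of `g` to the pairwise intersections of the design. -/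
theorem exists_hybrid [Infinite F] (𝒮 : Design n σ μ ρ) (g : MvPolynomial (Fin σ) F)
    {q : MvPolynomial (Fin n) F} (hq : q ≠ 0) (hKI : MvPolynomial.aeval (KI g 𝒮) q = 0) :
    ∃ u : Fin n → Polynomial (MvPolynomial (Fin σ) F),
      (∀ i, u i = Polynomial.X ∨ ∃ f : MvPolynomial (Fin σ) F, u i = Polynomial.C f ∧
        f.totalDegree ≤ g.totalDegree ∧ f.vars.card ≤ ρ - 1) ∧
      MvPolynomial.aeval u q ≠ 0 ∧ (MvPolynomial.aeval u q).eval g = 0 := by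
  -- `Z j`: the `j`-th hybrid polynomial vanishes at every point
  let Z : ℕ → Prop := fun j => ∀ (b : Fin n → F) (a : Fin μ → F),
    MvPolynomial.eval
      (fun i => if i.val < j then MvPolynomial.eval a (KI g 𝒮 i) else b i) q = 0
  have hZ0 : ¬ Z 0 := fun h => hq (MvPolynomial.funext fun b => by
    simpa using h b 0)
  have hZn : Z n := fun b a => by
    have := congrArg (MvPolynomial.eval a) hKI
    rw [MvPolynomial.map_aeval, map_zero] at this
    have h2 : (MvPolynomial.eval a).comp (algebraMap F (MvPolynomial (Fin μ) F)) =
        RingHom.id F := by ext; simp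
    rw [h2] at this
    simp only [Fin.is_lt, if_true]
    exact this
  obtain ⟨j, hjn, hj, hj1⟩ : ∃ j < n, ¬ Z j ∧ Z (j + 1) := by
    by_contra! hcon
    have : ∀ j ≤ n, ¬ Z j := by
      intro j
      induction j with
      | zero => exact fun _ => hZ0
      | succ j ih => exact fun h => hcon j (by omega) (ih (by omega))
    exact this n le_rfl hZn
  simp only [Z, not_forall] at hj
  obtain ⟨b, a, hab⟩ := hj
  let j' : Fin n := ⟨j, hjn⟩
  let S := 𝒮.S j'
  let em := S.orderIsoOfFin (𝒮.card_eq j')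
  let merge : (Fin σ → F) → Fin μ → F := fun c l =>
    if h : l ∈ S then c (em.symm ⟨l, h⟩) else a l
  let θ : Fin μ → MvPolynomial (Fin σ) F := fun l =>
    if h : l ∈ S then MvPolynomial.X (em.symm ⟨l, h⟩) else MvPolynomial.C (a l)
  let f : Fin n → MvPolynomial (Fin σ) F := fun i => MvPolynomial.aeval θ (KI g 𝒮 i)
  have hθ : ∀ c l, MvPolynomial.eval c (θ l) = merge c l := by
    intro c l
    by_cases h : l ∈ S <;> simp [θ, merge, h]
  have hf : ∀ c i, MvPolynomial.eval c (f i) = MvPolynomial.eval (merge c) (KI g 𝒮 i) := by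
    intro c i
    have h1 := MvPolynomial.map_aeval θ (MvPolynomial.eval c) (KI g 𝒮 i)
    have h2 : (MvPolynomial.eval c).comp (algebraMap F (MvPolynomial (Fin σ) F)) =
        RingHom.id F := by ext; simp
    simp only [h2, hθ] at h1
    exact h1
  have hmerge : ∀ c : Fin σ → F, (merge c) ∘ (S.orderEmbOfFin (𝒮.card_eq j')) = c := by
    intro c
    funext t
    have h1 : S.orderEmbOfFin (𝒮.card_eq j') t ∈ S := Finset.orderEmbOfFin_mem _ _ _
    have h2 : (⟨S.orderEmbOfFin (𝒮.card_eq j') t, h1⟩ : S) = em t := Subtype.ext rfl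
    simp only [Function.comp, merge, dif_pos h1, h2, OrderIso.symm_apply_apply]
  have hmerge' : merge (fun t => a (em t)) = a := by
    funext l
    by_cases h : l ∈ S <;> simp [merge, h]
  have hKIj : ∀ c, MvPolynomial.eval (merge c) (KI g 𝒮 j') = MvPolynomial.eval c g := by
    intro c
    rw [KI, MvPolynomial.eval_rename, hmerge]
  let u : Fin n → Polynomial (MvPolynomial (Fin σ) F) := fun i =>
    if i.val < j then Polynomial.C (f i) else if i = j' then Polynomial.X
    else Polynomial.C (MvPolynomial.C (b i))
  have hu : ∀ c p i, MvPolynomial.eval c ((u i).eval p) =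
      if i.val < j then MvPolynomial.eval (merge c) (KI g 𝒮 i) else
        if i = j' then MvPolynomial.eval c p else b i := by
    intro c p i
    simp only [u]
    split_ifs <;> simp [hf]
  refine ⟨u, fun i => ?_, fun h0 => ?_, ?_⟩
  · by_cases h1 : i.val < j
    · refine Or.inr ⟨f i, by simp [u, h1], ?_, ?_⟩
      · have hθ1 : ∀ l, (θ l).totalDegree ≤ 1 := fun l => by
          by_cases h : l ∈ S <;> simp [θ, h]
        refine (MvPolynomial.totalDegree_aeval_le_mul θ hθ1 _).trans ?_
        rw [mul_one]
        exact MvPolynomial.totalDegree_rename_le _ _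
      · have hne : i ≠ j' := fun h => by
          rw [h] at h1
          exact lt_irrefl _ h1
        have hcard := 𝒮.inter_lt i j' hne
        have hsub : (f i).vars ⊆ (𝒮.S i ∩ S).biUnion fun l => (θ l).vars := by
          have h2 : f i = MvPolynomial.bind₁
              (fun t => θ ((𝒮.S i).orderEmbOfFin (𝒮.card_eq i) t)) g := by
            simp only [f, KI, MvPolynomial.aeval_rename]
            rfl
          rw [h2]
          refine (MvPolynomial.vars_bind₁ _ _).trans ?_
          intro v hv
          rw [Finset.mem_biUnion] at hv ⊢
          obtain ⟨t, -, hv⟩ := hv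
          refine ⟨_, Finset.mem_inter.2 ⟨Finset.orderEmbOfFin_mem _ (𝒮.card_eq i) t, ?_⟩, hv⟩
          by_contra hS
          simp [θ, hS] at hv
        have hle : ((𝒮.S i ∩ S).biUnion fun l => (θ l).vars).card ≤ (𝒮.S i ∩ S).card := by
          refine (Finset.card_biUnion_le_card_mul _ _ 1 fun l _ => ?_).trans (mul_one _).le
          by_cases h : l ∈ S <;> simp [θ, h]
        have := (Finset.card_le_card hsub).trans hle
        change (𝒮.S i ∩ S).card < ρ at hcard
        omega
    · by_cases h2 : i = j'
      · left
        simp only [u, if_neg h1, if_pos h2]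
      · exact Or.inr ⟨MvPolynomial.C (b i), by simp [u, h1, h2], by simp, by simp⟩
  · apply hab
    have h3 := eval_eval_aeval u (fun t => a (em t)) (MvPolynomial.C (b j')) q
    rw [h0, Polynomial.eval_zero, map_zero] at h3
    rw [h3]
    congr 1
    congr 1
    funext i
    rw [hu, hmerge']
    by_cases h2 : i = j'
    · subst h2; simp [j']
    · simp [h2]
  · refine MvPolynomial.funext fun c => ?_
    rw [eval_eval_aeval, map_zero, ← hj1 b (merge c)]
    congr 1
    congr 1
    funext i
    rw [hu]
    by_cases h1 : i.val < j
    · rw [if_pos h1, if_pos (by omega)]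
    · by_cases h2 : i = j'
      · subst h2
        rw [if_neg h1, if_pos rfl, if_pos (Nat.lt_succ_self j), hKIj]
      · have : ¬ i.val < j + 1 := fun h => h2 (Fin.ext (by simp only [j']; omega))
        rw [if_neg h1, if_neg h2, if_neg this]

end Hybrid

/-! ### Roots of cheap polynomials, and hardness of the generator -/

section Root

open Polynomial

variable {F : Type*} [Field F] [CharZero F] {M : ℕ}

theorem natDegree_iterate_derivative_le {R : Type*} [CommRing R] (p : R[X]) (m : ℕ) :
    (derivative^[m] p).natDegree ≤ p.natDegree :=
  (natDegree_iterate_derivative p m).trans (Nat.sub_le _ _)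

/-- Values of iterated derivatives are linear functionals of the coefficients. -/
theorem Comp.iterate_derivative (hM : 2 ≤ M) {Y : Type*} {p : (MvPolynomial Y F)[X]} {Δ a e b : ℕ}
    (hp : ∀ x : F, Comp M Δ a e (p.eval (MvPolynomial.C x))) (hb : p.natDegree < M ^ b)
    (m : ℕ) (x : F) :
    Comp M (Δ + 2) (a + b + 3) e ((derivative^[m] p).eval (MvPolynomial.C x)) := by
  convert Comp.of_eval hM hp hb fun j => (j.descFactorial m : F) * x ^ (j - m) using 1
  conv_lhs => rw [p.as_sum_range_C_mul_X_pow' hb]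
  rw [iterate_derivative_sum, eval_finsetSum]
  refine Finset.sum_congr rfl fun j _ => ?_
  rw [iterate_derivative_C_mul, iterate_derivative_X_pow_eq_smul]
  simp
  ring

/-- A nonzero polynomial over a domain of characteristic zero with root `t` has an iterated
derivative of which `t` is a simple root. -/
theorem exists_iterate_derivative_simple_root {R : Type*} [CommRing R] [IsDomain R] [CharZero R]
    {p : R[X]} (hp : p ≠ 0) {t : R} (ht : p.eval t = 0) :
    ∃ m, (derivative^[m] p).eval t = 0 ∧ (derivative (derivative^[m] p)).eval t ≠ 0 := by
  by_contra! hcon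
  have hall : ∀ m, (derivative^[m] p).eval t = 0 := by
    intro m
    induction m with
    | zero => exact ht
    | succ m ih =>
      rw [Function.iterate_succ_apply']
      exact hcon m ih
  exact lt_irrefl _ ((lt_rootMultiplicity_iff_isRoot_iterate_derivative hp).2
    fun m (_ : m ≤ p.rootMultiplicity t) => hall m)

/-- A root of degree `d` of a cheap univariate polynomial over a polynomial ring is cheap. After
passing to a simple root and substituting `w = a + τ (w - a)` for a suitable point `a`, it becomes a
non-degenerate root of order `d + 1` with respect to `τ`. -/
theorem Comp.of_root (hM : 2 ≤ M) {Y : Type*} {p : (MvPolynomial Y F)[X]} (hp0 : p ≠ 0)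
    {g : MvPolynomial Y F} (hg : p.eval g = 0) (hd : g.totalDegree + 1 ≤ M) {Δ a e : ℕ}
    (hp : ∀ x : F, Comp M Δ a e (p.eval (MvPolynomial.C x))) (hb : p.natDegree < M ^ e) :
    Comp M (Δ + 16) (a + 3 * e + 42) (e + 3) g := by
  obtain ⟨m, hm0, hm1⟩ := exists_iterate_derivative_simple_root hp0 hg
  set P := derivative^[m] p with hP
  have hPc : ∀ x : F, Comp M (Δ + 2) (a + e + 3) e (P.eval (MvPolynomial.C x)) :=
    fun x => Comp.iterate_derivative hM hp hb m x
  have hPb : P.natDegree < M ^ e := (natDegree_iterate_derivative_le p m).trans_lt hb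
  obtain ⟨pt, hpt⟩ : ∃ pt, MvPolynomial.eval pt ((derivative P).eval g) ≠ 0 := by
    by_contra! h
    exact hm1 (MvPolynomial.funext fun b => by rw [h b, map_zero])
  let ψ : MvPolynomial Y F →ₐ[F] (MvPolynomial Y F)[X] := MvPolynomial.aeval fun t =>
    C (MvPolynomial.C (pt t)) + X * C (MvPolynomial.X t - MvPolynomial.C (pt t))
  have hψdeg : ∀ f, (ψ f).natDegree ≤ f.totalDegree := fun f => by
    refine MvPolynomial.natDegree_aeval_le_totalDegree _ (fun t => ?_) f
    refine (natDegree_add_le _ _).trans (max_le (by simp) ?_)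
    exact natDegree_mul_le.trans (by rw [natDegree_C, add_zero]; exact natDegree_X_le)
  have hψC : ∀ x, ψ (MvPolynomial.C x) = C (MvPolynomial.C x) := fun x => by
    simp [ψ, Polynomial.algebraMap_apply]
  have hψ0 : ∀ f, (ψ f).coeff 0 = MvPolynomial.C (MvPolynomial.eval pt f) := by
    intro f
    have : (constantCoeff (R := MvPolynomial Y F)).comp (ψ : MvPolynomial Y F →+* (MvPolynomial Y F)[X]) =
        MvPolynomial.C.comp (MvPolynomial.eval pt) := by
      apply MvPolynomial.ringHom_ext
      · intro x; simp [hψC]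
      · intro t; simp [ψ]
    exact congrArg (fun φ => φ f) this
  have hψ1 : ∀ f, (ψ f).eval 1 = f := by
    intro f
    have : (evalRingHom (1 : MvPolynomial Y F)).comp (ψ : MvPolynomial Y F →+* (MvPolynomial Y F)[X]) =
        RingHom.id _ := by
      apply MvPolynomial.ringHom_ext
      · intro x; simp [hψC]
      · intro t; simp [ψ]
    exact congrArg (fun φ => φ f) this
  have hψy : ∀ y f, (ψ f).eval (MvPolynomial.C y) = MvPolynomial.aeval (fun t =>
      MvPolynomial.C (pt t - y * pt t) + MvPolynomial.C y * MvPolynomial.X t) f := by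
    intro y f
    have : (evalRingHom (MvPolynomial.C y : MvPolynomial Y F)).comp
        (ψ : MvPolynomial Y F →+* (MvPolynomial Y F)[X]) =
        (MvPolynomial.aeval (R := F) (fun t => MvPolynomial.C (pt t - y * pt t) +
          MvPolynomial.C y * MvPolynomial.X t : Y → MvPolynomial Y F)).toRingHom := by
      apply MvPolynomial.ringHom_ext
      · intro x; simp [hψC]
      · intro t
        simp [ψ]
        ring
    exact congrArg (fun φ => φ f) this
  have hψeval : ∀ (Q : (MvPolynomial Y F)[X]) (f : MvPolynomial Y F),
      (Q.map (ψ : MvPolynomial Y F →+* (MvPolynomial Y F)[X])).eval (ψ f) = ψ (Q.eval f) :=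
    fun Q f => eval_map_apply (f := (ψ : MvPolynomial Y F →+* (MvPolynomial Y F)[X])) f
  have key := fun j => Comp.coeff_of_approxRoot hM (A := P.map (ψ : MvPolynomial Y F →+* (MvPolynomial Y F)[X]))
    (φ := ψ g) (α := MvPolynomial.eval pt g)
    (ε := MvPolynomial.eval pt ((derivative P).eval g)) (k := g.totalDegree + 1) (Δ := Δ + 5)
    (a := a + e + 10) (b := e) (e := e) (Nat.succ_pos _) hd (Nat.lt_succ_of_le (hψdeg g))
    (by rw [hψeval, hm0, map_zero]; exact dvd_zero _) (hψ0 g) hpt ?_ ?_ ?_ ?_ j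
  · have h1 : g = ∑ j ∈ Finset.range (g.totalDegree + 1), (ψ g).coeff j := by
      conv_lhs => rw [← hψ1 g, eval_eq_sum_range' (Nat.lt_succ_of_le (hψdeg g))]
      simp
    rw [h1]
    exact (Comp.sum hM (b := 1) _ (fun j _ => key j) (by simpa using hd)).mono hM (by omega)
      (by omega) le_rfl
  · rw [derivative_map, ← hψC, hψeval, hψ0, ← eval_map_apply, ← eval_map_apply]
    simp
  · exact natDegree_map_le.trans hPb.le
  · intro i
    rw [coeff_map]
    exact (hψdeg _).trans (Comp.coeff hM hPc hPb i).2
  · intro x y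
    rw [← hψC, hψeval, hψy]
    refine (Comp.aeval hM (hPc x) (Δ' := 2) (a' := 4) (e' := 0) fun t => ?_).mono hM le_rfl
      (by omega) le_rfl
    exact Comp.add hM (comp_C _ _ _ _) ⟨((comp_X hM t 0 0 0).C_mul hM y).1, by
      refine (MvPolynomial.totalDegree_mul _ _).trans ?_
      simp⟩

/-- If a nonzero cheap polynomial vanishes on the generator built from `g`, then `g` is cheap. -/
theorem Comp.of_KI_eq_zero (hM : 2 ≤ M) {n σ μ ρ : ℕ} (𝒮 : Design n σ μ ρ)
    (g : MvPolynomial (Fin σ) F) {q : MvPolynomial (Fin n) F} (hq0 : q ≠ 0)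
    (hKI : MvPolynomial.aeval (KI g 𝒮) q = 0) (hρ : 1 ≤ ρ) (hd : g.totalDegree + 1 ≤ M)
    (hρM : ρ ^ g.totalDegree ≤ M) {Δ a e : ℕ} (hq : Comp M Δ a e q) :
    Comp M (Δ + 21) (a + 3 * e + 56) (e + 4) g := by
  obtain ⟨u, hu, hne, hroot⟩ := exists_hybrid 𝒮 g hq0 hKI
  have hp : ∀ x : F, Comp M (Δ + 5) (a + 11) (e + 1)
      ((MvPolynomial.aeval u q).eval (MvPolynomial.C x)) := by
    intro x
    have h1 : (MvPolynomial.aeval u q).eval (MvPolynomial.C x) =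
        MvPolynomial.aeval (fun i => (u i).eval (MvPolynomial.C x)) q :=
      MvPolynomial.funext fun c => by
        rw [eval_eval_aeval, MvPolynomial.map_aeval]
        have : (MvPolynomial.eval c).comp (algebraMap F (MvPolynomial (Fin σ) F)) =
            RingHom.id F := by ext; simp
        rw [this]
        rfl
    rw [h1]
    refine (Comp.aeval hM hq (Δ' := 4) (a' := 8) (e' := 1) fun i => ?_).mono hM le_rfl le_rfl le_rfl
    obtain h2 | ⟨f, h2, hf1, hf2⟩ := hu i
    · rw [h2, eval_X]
      exact comp_C _ _ _ _
    · rw [h2, eval_C]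
      refine comp_of_card_vars_le hM hf1 hf2 (by omega) ?_
      rwa [Nat.sub_add_cancel hρ]
  have hdeg : (MvPolynomial.aeval u q).natDegree < M ^ (e + 1) := by
    have h1 := MvPolynomial.natDegree_aeval_le_totalDegree u (fun i => by
      obtain h2 | ⟨f, h2, -⟩ := hu i
      · rw [h2]; exact natDegree_X_le
      · rw [h2]; simp) q
    exact (h1.trans hq.2).trans_lt (Nat.pow_lt_pow_right (by omega) (Nat.lt_succ_self e))
  exact (Comp.of_root hM hne hroot hd hp hdeg).mono hM (by omega) (by omega) (by omega)

/-- For pairwise disjoint sets the generator hits every nonzero polynomial, unless `g` is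
constant. -/
theorem exists_eq_C_of_KI_eq_zero {n σ μ ρ : ℕ} (𝒮 : Design n σ μ ρ)
    (g : MvPolynomial (Fin σ) F) {q : MvPolynomial (Fin n) F} (hq0 : q ≠ 0)
    (hKI : MvPolynomial.aeval (KI g 𝒮) q = 0) (hρ : ρ ≤ 1) : ∃ c, g = MvPolynomial.C c := by
  obtain ⟨u, hu, hne, hroot⟩ := exists_hybrid 𝒮 g hq0 hKI
  have hu' : ∀ i, ∃ v : F[X], u i = v.map MvPolynomial.C := by
    intro i
    obtain h2 | ⟨f, h2, -, hf⟩ := hu i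
    · exact ⟨X, by simp [h2]⟩
    · refine ⟨C (f.coeff 0), ?_⟩
      have hv : f.vars = ∅ := Finset.card_eq_zero.1 (by omega)
      rw [h2, map_C, ← MvPolynomial.vars_eq_empty_iff_eq_C.1 hv]
  choose v hv using hu'
  have hmap : MvPolynomial.aeval u q = (MvPolynomial.aeval v q).map MvPolynomial.C := by
    have h1 := MvPolynomial.map_aeval v
      (mapRingHom (MvPolynomial.C : F →+* MvPolynomial (Fin σ) F)) q
    have h2 : (mapRingHom (MvPolynomial.C : F →+* MvPolynomial (Fin σ) F)).comp
        (algebraMap F F[X]) = algebraMap F _ := by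
      ext x; simp [Polynomial.algebraMap_apply]
    rw [h2] at h1
    rw [← coe_mapRingHom, h1, funext hv]
    rfl
  rw [hmap] at hne hroot
  exact MvPolynomial.exists_eq_C_of_eval_map_eq_zero (fun h => hne (by rw [h, Polynomial.map_zero]))
    hroot

end Root

/-! ### Polynomials in `T, x, z` as iterated univariate polynomials -/

section Views

open Polynomial

variable {F : Type*} [Field F] {ι κ : Type*}

/-- `F[T, x]` viewed as `F[x][T]`. -/
def viewT : MvPolynomial (VarTX ι) F →ₐ[F] (MvPolynomial ι F)[X] :=
  MvPolynomial.aeval fun v : VarTX ι => match v with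
    | .T => X
    | .x i => C (MvPolynomial.X i)

/-- `F[T, x, z]` viewed as `F[x][T][z]`. -/
def viewTZ : MvPolynomial (VarTXZ ι) F →ₐ[F] (MvPolynomial ι F)[X][X] :=
  MvPolynomial.aeval fun v : VarTXZ ι => match v with
    | .T => C X
    | .x i => C (C (MvPolynomial.X i))
    | .z => X

theorem viewT_injective : Function.Injective (viewT (F := F) (ι := ι)) := by
  let back : (MvPolynomial ι F)[X] →+* MvPolynomial (VarTX ι) F :=
    eval₂RingHom (MvPolynomial.rename VarTX.x).toRingHom (MvPolynomial.X .T)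
  have : back.comp (viewT (F := F) (ι := ι)).toRingHom = RingHom.id _ := by
    apply MvPolynomial.ringHom_ext
    · intro c
      simp [back, viewT, Polynomial.algebraMap_apply]
    · rintro (_ | i) <;> simp [back, viewT]
  exact Function.LeftInverse.injective (g := back) fun p => congrArg (fun φ => φ p) this

theorem viewT_substZ (P : MvPolynomial (VarTXZ ι) F) (Φ : MvPolynomial (VarTX ι) F) :
    viewT (substZ P Φ) = (viewTZ P).eval (viewT Φ) := by
  have : (viewT (F := F) (ι := ι)).toRingHom.comp (MvPolynomial.aeval (R := F)
      (fun v : VarTXZ ι => match v with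
        | .T => MvPolynomial.X .T
        | .x i => MvPolynomial.X (.x i)
        | .z => Φ)).toRingHom =
      (evalRingHom (viewT Φ)).comp (viewTZ (F := F) (ι := ι)).toRingHom := by
    apply MvPolynomial.ringHom_ext
    · intro c
      simp [viewT, viewTZ, Polynomial.algebraMap_apply]
    · rintro (_ | i | _) <;> simp [viewT, viewTZ]
  exact congrArg (fun φ => φ P) this

theorem viewT_substXInTX (h : ι → MvPolynomial κ F) (Q : MvPolynomial (VarTX ι) F) :
    viewT (substXInTX h Q) = (viewT Q).map (MvPolynomial.aeval (R := F) h).toRingHom := by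
  have hx : ∀ p : MvPolynomial κ F, viewT (MvPolynomial.rename VarTX.x p) = C p := by
    intro p
    have : (viewT (F := F) (ι := κ)).toRingHom.comp (MvPolynomial.rename VarTX.x).toRingHom =
        C := by
      apply MvPolynomial.ringHom_ext
      · intro c
        simp [viewT, Polynomial.algebraMap_apply]
      · intro i
        simp [viewT]
    exact congrArg (fun φ => φ p) this
  have : (viewT (F := F) (ι := κ)).toRingHom.comp (MvPolynomial.aeval (R := F)
      (fun v : VarTX ι => match v with
        | .T => MvPolynomial.X .T
        | .x i => MvPolynomial.rename VarTX.x (h i))).toRingHom =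
      (mapRingHom (MvPolynomial.aeval (R := F) h).toRingHom).comp
        (viewT (F := F) (ι := ι)).toRingHom := by
    apply MvPolynomial.ringHom_ext
    · intro c
      simp [viewT, Polynomial.algebraMap_apply]
    · rintro (_ | i)
      · simp [viewT]
      · simp [hx]
        simp [viewT]
  exact congrArg (fun φ => φ Q) this

theorem substZ_substXInTXZ (h : ι → MvPolynomial κ F) (P : MvPolynomial (VarTXZ ι) F)
    (Φ : MvPolynomial (VarTX ι) F) :
    substZ (substXInTXZ h P) (substXInTX h Φ) = substXInTX h (substZ P Φ) := by
  have hx : ∀ p : MvPolynomial κ F,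
      substZ (MvPolynomial.rename VarTXZ.x p) (substXInTX h Φ) = MvPolynomial.rename VarTX.x p := by
    intro p
    rw [substZ, MvPolynomial.aeval_rename]
    exact congrArg (fun φ => φ p) (MvPolynomial.algHom_ext
      (f := MvPolynomial.aeval fun i => MvPolynomial.X (VarTX.x i))
      (g := MvPolynomial.rename VarTX.x) fun i => by simp)
  induction P using MvPolynomial.induction_on with
  | C c => simp [substZ, substXInTXZ, substXInTX]
  | add p q hp hq =>
    simp only [substZ, substXInTXZ, substXInTX, map_add] at hp hq ⊢
    rw [hp, hq]
  | mul_X p v hp =>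
    have hv : substZ (substXInTXZ h (MvPolynomial.X v)) (substXInTX h Φ) =
        substXInTX h (substZ (MvPolynomial.X v) Φ) := by
      rcases v with _ | i | _
      · simp [substZ, substXInTXZ, substXInTX]
      · have h1 : substXInTXZ h (MvPolynomial.X (.x i) : MvPolynomial (VarTXZ ι) F) =
            MvPolynomial.rename VarTXZ.x (h i) := by simp [substXInTXZ]
        rw [h1, hx]
        simp [substZ, substXInTX]
      · simp [substZ, substXInTXZ, substXInTX]
    simp only [substZ, substXInTXZ, substXInTX, map_mul] at hp hv ⊢
    rw [hp, hv]

/-- The degree in `T` is read off with weight `1` on `T` and `0` on the other variables. -/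
theorem natDegree_viewT_le (Φ : MvPolynomial (VarTX ι) F) :
    (viewT Φ).natDegree ≤ Φ.degreeOf .T := by
  classical
  refine MvPolynomial.natDegree_aeval_le _ (fun v => match v with | .T => 1 | .x _ => 0) ?_ Φ ?_
  · rintro (_ | i)
    · exact natDegree_X_le
    · exact (natDegree_C _).le
  · intro m hm
    refine le_trans ?_ (MvPolynomial.monomial_le_degreeOf .T hm)
    by_cases hT : VarTX.T ∈ m.support
    · rw [Finset.sum_eq_single VarTX.T]
      · simp
      · rintro (_ | i) _ hne
        · exact absurd rfl hne
        · simp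
      · exact fun h => absurd hT h
    · rw [Finset.sum_eq_zero]
      · exact Nat.zero_le _
      · rintro (_ | i) hi
        · exact absurd hi hT
        · simp

theorem natDegree_viewTZ_le (P : MvPolynomial (VarTXZ ι) F) :
    (viewTZ P).natDegree ≤ P.totalDegree := by
  refine MvPolynomial.natDegree_aeval_le_totalDegree _ ?_ P
  rintro (_ | i | _)
  · simp
  · simp
  · exact natDegree_X_le

theorem natDegree_coeff_viewTZ_le (P : MvPolynomial (VarTXZ ι) F) (j : ℕ) :
    ((viewTZ P).coeff j).natDegree ≤ P.totalDegree := by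
  rw [viewTZ, MvPolynomial.aeval_def, MvPolynomial.eval₂_eq, finsetSum_coeff]
  refine natDegree_sum_le_of_forall_le _ _ fun m hm => ?_
  rw [Polynomial.algebraMap_apply, coeff_C_mul]
  refine natDegree_mul_le.trans ?_
  rw [Polynomial.algebraMap_apply, natDegree_C, zero_add]
  refine le_trans (natDegree_coeff_prod_le _ (n := fun v => m v) (fun v _ i => ?_) j)
    (MvPolynomial.le_totalDegree hm)
  refine (natDegree_coeff_pow_le (n := 1) (fun i => ?_) _ i).trans (mul_one _).le
  rcases v with _ | i' | _
  · exact natDegree_coeff_C_le natDegree_X_le i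
  · exact natDegree_coeff_C_le (by simp) i
  · exact (natDegree_coeff_X_le i).trans (Nat.zero_le 1)

theorem eval_eval_viewTZ (P : MvPolynomial (VarTXZ ι) F) (x y : F) :
    ((viewTZ P).eval (C (MvPolynomial.C x))).eval (MvPolynomial.C y) =
      MvPolynomial.aeval (fun v : VarTXZ ι => match v with
        | .T => MvPolynomial.C y
        | .x i => MvPolynomial.X i
        | .z => (MvPolynomial.C x : MvPolynomial ι F)) P := by
  have : ((evalRingHom (MvPolynomial.C y : MvPolynomial ι F)).comp
      (evalRingHom (C (MvPolynomial.C x)))).comp (viewTZ (F := F) (ι := ι)).toRingHom =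
      (MvPolynomial.aeval (R := F) (fun v : VarTXZ ι => match v with
        | .T => MvPolynomial.C y
        | .x i => MvPolynomial.X i
        | .z => (MvPolynomial.C x : MvPolynomial ι F))).toRingHom := by
    apply MvPolynomial.ringHom_ext
    · intro c
      simp [viewTZ, Polynomial.algebraMap_apply]
    · rintro (_ | i | _) <;> simp [viewTZ]
  exact congrArg (fun φ => φ P) this

/-- The univariate polynomial `P(0, 0, z)`. -/
def atZero : MvPolynomial (VarTXZ ι) F →ₐ[F] F[X] :=
  MvPolynomial.aeval fun v : VarTXZ ι => match v with
    | .T => 0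
    | .x _ => 0
    | .z => X

/-- For `T`-regularized `P` one has `P(0, x, z) = P(0, 0, z)`. -/
theorem TRegularized.map_viewTZ {P : MvPolynomial (VarTXZ ι) F} (hP : TRegularized P) :
    (viewTZ P).map constantCoeff = (atZero P).map MvPolynomial.C := by
  have h1 := MvPolynomial.map_aeval (R := F) (fun v : VarTXZ ι => match v with
    | .T => C X
    | .x i => C (C (MvPolynomial.X i))
    | .z => (X : (MvPolynomial ι F)[X][X])) (mapRingHom constantCoeff) P
  have h2 := MvPolynomial.map_aeval (R := F) (fun v : VarTXZ ι => match v with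
    | .T => 0
    | .x _ => 0
    | .z => (X : F[X])) (mapRingHom (MvPolynomial.C : F →+* MvPolynomial ι F)) P
  rw [viewTZ, atZero, ← coe_mapRingHom, ← coe_mapRingHom]
  refine h1.trans (Eq.trans ?_ h2.symm)
  have h3 : (mapRingHom (constantCoeff (R := MvPolynomial ι F))).comp
      (algebraMap F (MvPolynomial ι F)[X][X]) =
      (mapRingHom (MvPolynomial.C : F →+* MvPolynomial ι F)).comp (algebraMap F F[X]) := by
    ext c
    simp [Polynomial.algebraMap_apply]
  rw [h3, MvPolynomial.coe_eval₂Hom, MvPolynomial.coe_eval₂Hom, MvPolynomial.eval₂_eq,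
    MvPolynomial.eval₂_eq]
  refine Finset.sum_congr rfl fun m hm => ?_
  congr 1
  by_cases hx : ∃ i : ι, m (.x i) ≠ 0
  · have hT := hP m hm hx
    have hT' : VarTXZ.T ∈ m.support := Finsupp.mem_support_iff.2 hT
    rw [Finset.prod_eq_zero hT', Finset.prod_eq_zero hT'] <;> simp [hT]
  · push Not at hx
    refine Finset.prod_congr rfl fun v hv => ?_
    rcases v with _ | i | _
    · simp
    · exact absurd (hx i) (Finsupp.mem_support_iff.1 hv)
    · simp

theorem derivative_atZero (P : MvPolynomial (VarTXZ ι) F) :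
    derivative (atZero P) = atZero (MvPolynomial.pderiv .z P) := by
  classical
  induction P using MvPolynomial.induction_on with
  | C c => simp [atZero]
  | add p q hp hq => simp only [map_add, hp, hq]
  | mul_X p v hp =>
    rw [map_mul, derivative_mul, hp, MvPolynomial.pderiv_mul, map_add, map_mul, map_mul]
    congr 2
    rcases v with _ | i | _
    · simp [atZero, MvPolynomial.pderiv_X]
    · simp [atZero, MvPolynomial.pderiv_X]
    · simp [atZero]

theorem IsNondegenerate.eval_ne_zero {P : MvPolynomial (VarTXZ ι) F}
    {Φ : MvPolynomial (VarTX ι) F} (h : IsNondegenerate P Φ) :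
    (derivative (atZero P)).eval (MvPolynomial.eval (fun _ => 0) Φ) ≠ 0 := by
  rw [derivative_atZero]
  have : ((evalRingHom (MvPolynomial.eval (fun _ => 0) Φ)).comp
      (atZero (F := F) (ι := ι)).toRingHom) =
      MvPolynomial.eval (fun v : VarTXZ ι => match v with
        | .T => 0
        | .x _ => 0
        | .z => MvPolynomial.eval (fun _ => 0) Φ) := by
    apply MvPolynomial.ringHom_ext
    · intro c
      simp [atZero]
    · rintro (_ | i | _) <;> simp [atZero]
  have h2 := congrArg (fun φ => φ (MvPolynomial.pderiv .z P)) this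
  intro h0
  exact h (h2.symm.trans h0)

theorem constantCoeff_eval_viewTZ {P : MvPolynomial (VarTXZ ι) F} (hP : TRegularized P)
    (p : (MvPolynomial ι F)[X]) :
    ((viewTZ P).eval p).coeff 0 = ((atZero P).map MvPolynomial.C).eval (p.coeff 0) := by
  rw [← hP.map_viewTZ]
  exact (eval_map_apply (f := (constantCoeff (R := MvPolynomial ι F))) p).symm

/-- Modulo `T`, an approximate root of a `T`-regularized polynomial is constant. -/
theorem IsApproxRoot.coeff_zero_viewT [Infinite F] {P : MvPolynomial (VarTXZ ι) F}
    {Φ : MvPolynomial (VarTX ι) F} {k : ℕ} (hk : 0 < k) (hP : TRegularized P)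
    (hroot : X ^ k ∣ (viewTZ P).eval (viewT Φ)) (hnd : IsNondegenerate P Φ) :
    (viewT Φ).coeff 0 = MvPolynomial.C (MvPolynomial.eval (fun _ => 0) Φ) := by
  have h1 : ((atZero P).map MvPolynomial.C).eval ((viewT Φ).coeff 0) = 0 := by
    rw [← constantCoeff_eval_viewTZ hP]
    exact X_pow_dvd_iff.1 hroot 0 hk
  have h2 : atZero P ≠ 0 := fun h => hnd.eval_ne_zero (by rw [h]; simp)
  obtain ⟨c, hc⟩ := MvPolynomial.exists_eq_C_of_eval_map_eq_zero h2 h1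
  have h3 : ((MvPolynomial.eval fun _ => (0 : F)).comp
      (constantCoeff (R := MvPolynomial ι F))).comp (viewT (F := F) (ι := ι)).toRingHom =
      MvPolynomial.eval fun _ => 0 := by
    apply MvPolynomial.ringHom_ext
    · intro c
      simp [viewT, Polynomial.algebraMap_apply]
    · rintro (_ | i) <;> simp [viewT]
  have h4 : MvPolynomial.eval (fun _ => 0) ((viewT Φ).coeff 0) =
      MvPolynomial.eval (fun _ => 0) Φ := congrArg (fun φ => φ Φ) h3
  rw [← h4, hc, MvPolynomial.eval_C]

end Views

/-! ### The composition with an approximate root -/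

section Composition

open Polynomial

variable {F : Type*} [Field F] [CharZero F] {ι : Type*} {M : ℕ}

/-- The coefficients of `P(T, x, Φ(T, x))` with respect to `T` are cheap. -/
theorem Comp.coeff_viewT_substZ (hM : 2 ≤ M) {P : MvPolynomial (VarTXZ ι) F}
    {Φ : MvPolynomial (VarTX ι) F} {k Δ : ℕ} (hk : 0 < k) (hkM : k ≤ M)
    (hP : Comp M Δ 1 1 P) (hreg : TRegularized P) (hroot : IsApproxRoot P Φ k)
    (htr : IsTruncated Φ k) (hnd : IsNondegenerate P Φ) (i : ℕ) :
    Comp M (Δ + 18) 55 7 ((viewT (substZ P Φ)).coeff i) := by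
  have hroot' : X ^ k ∣ (viewTZ P).eval (viewT Φ) := by
    have := _root_.map_dvd (viewT (F := F) (ι := ι)) hroot
    rw [map_pow, viewT_substZ] at this
    simpa [viewT] using this
  have hφk : (viewT Φ).natDegree < k := (natDegree_viewT_le Φ).trans_lt htr
  have hD : P.totalDegree ≤ M ^ 1 := hP.2
  have heval : ∀ x y : F, Comp M (Δ + 1) 4 1
      (((viewTZ P).eval (C (MvPolynomial.C x))).eval (MvPolynomial.C y)) := by
    intro x y
    rw [eval_eval_viewTZ]
    refine (Comp.aeval hM hP (Δ' := 0) (a' := 0) (e' := 0) ?_).mono hM le_rfl le_rfl le_rfl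
    rintro (_ | i | _)
    · exact comp_C _ _ _ _
    · exact comp_X hM _ _ _ _
    · exact comp_C _ _ _ _
  have hΦ0 := IsApproxRoot.coeff_zero_viewT hk hreg hroot' hnd
  have hder : ((derivative (viewTZ P)).eval
      (C (MvPolynomial.C (MvPolynomial.eval (fun _ => 0) Φ)))).coeff 0 =
      MvPolynomial.C ((derivative (atZero P)).eval (MvPolynomial.eval (fun _ => 0) Φ)) := by
    have h1 : ((derivative (viewTZ P)).map (constantCoeff (R := MvPolynomial ι F))).eval
        (MvPolynomial.C (MvPolynomial.eval (fun _ => 0) Φ)) =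
        MvPolynomial.C ((derivative (atZero P)).eval (MvPolynomial.eval (fun _ => 0) Φ)) := by
      rw [← derivative_map, hreg.map_viewTZ, derivative_map, eval_map_apply]
    rw [← h1]
    have h2 := eval_map_apply (f := (constantCoeff (R := MvPolynomial ι F)))
      (p := derivative (viewTZ P)) (C (MvPolynomial.C (MvPolynomial.eval (fun _ => 0) Φ)))
    rw [constantCoeff_apply, constantCoeff_apply, coeff_C_zero] at h2
    exact h2.symm
  have hcoef : ∀ j, Comp M (Δ + 11) 36 4 ((viewT Φ).coeff j) :=
    Comp.coeff_of_approxRoot hM hk hkM hφk hroot' hΦ0 hnd.eval_ne_zero hder (b := 1)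
      ((natDegree_viewTZ_le P).trans hD) (fun j => (natDegree_coeff_viewTZ_le P j).trans hD) heval
  have hzdeg : (viewTZ P).natDegree < M ^ 2 :=
    ((natDegree_viewTZ_le P).trans hD).trans_lt (Nat.pow_lt_pow_right (by omega) (by omega))
  have hsum := eval_eq_sum_range' hzdeg (viewT Φ)
  have hTdeg : ((viewTZ P).eval (viewT Φ)).natDegree < M ^ 4 := by
    have h2 : M ^ 1 + M ^ 1 * M < M ^ 4 := by
      have : 4 ≤ M * M := Nat.mul_le_mul hM hM
      nlinarith [Nat.mul_le_mul this (le_refl (M * M))]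
    refine lt_of_le_of_lt ?_ h2
    rw [eval_eq_sum_range]
    refine natDegree_sum_le_of_forall_le _ _ fun j hj => ?_
    refine natDegree_mul_le.trans (add_le_add ((natDegree_coeff_viewTZ_le P j).trans hD) ?_)
    refine natDegree_pow_le.trans (Nat.mul_le_mul ?_ (by omega))
    exact (Nat.lt_succ_iff.1 (Finset.mem_range.1 hj)).trans ((natDegree_viewTZ_le P).trans hD)
  rw [viewT_substZ]
  refine (Comp.coeff hM (Δ := Δ + 16) (a := 48) (e := 7) (fun y => ?_) hTdeg i).mono hM le_rfl
    le_rfl le_rfl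
  rw [hsum, eval_finsetSum]
  refine Comp.sum hM (Δ := Δ + 15) (a := 45) (b := 2) _ (fun j hj => ?_) (by simp)
  rw [eval_mul, eval_pow]
  refine Comp.mul hM (Δ := Δ + 14) (a := 43) (e := 6) ?_ ?_
  · let ev := evalRingHom (MvPolynomial.C y : MvPolynomial ι F)
    have h1 : ((viewTZ P).coeff j).eval (MvPolynomial.C y) = ((viewTZ P).map ev).coeff j := by
      rw [coeff_map]; rfl
    rw [h1]
    refine (Comp.coeff hM (Δ := Δ + 1) (a := 4) (e := 1) (fun x => ?_)
      (natDegree_map_le.trans_lt hzdeg) j).mono hM (by omega) (by omega) (by omega)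
    have h2 : (MvPolynomial.C x : MvPolynomial ι F) = ev (C (MvPolynomial.C x)) := by simp [ev]
    rw [h2, eval_map_apply]
    exact heval x y
  · refine Comp.pow hM (Δ := Δ + 13) (a := 40) (e := 4) (b := 2) ?_
      (Finset.mem_range.1 hj).le
    have h1 : (viewT Φ).eval (MvPolynomial.C y) =
        ∑ l ∈ Finset.range k, MvPolynomial.C (y ^ l) * (viewT Φ).coeff l := by
      rw [eval_eq_sum_range' hφk]
      exact Finset.sum_congr rfl fun l _ => by rw [MvPolynomial.C_pow, mul_comm]
    rw [h1]
    exact Comp.lincomb hM _ _ (fun l _ => hcoef l) (b := 1) (by simpa using hkM)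

end Composition

/-! ### The hardness-randomness theorem -/

theorem pow_le_rootSizeBound {c s D k ρ d : ℕ} (hc : 1 ≤ c) (hk : 1 < k) (hρ : 1 ≤ ρ) :
    ((((s + D + k) * ρ ^ (d + 1)) ^ c : ℕ) : ℝ) ≤ rootSizeBound c s D k ρ d := by
  have hlog : 1 ≤ Real.logb 2 k := by
    rw [Real.le_logb_iff_rpow_le (by norm_num) (by positivity), Real.rpow_one]
    exact_mod_cast hk
  have hρ' : (1 : ℝ) ≤ ρ := by exact_mod_cast hρ
  have hbase : (ρ : ℝ) ≤ ρ * Real.logb 2 k := le_mul_of_one_le_right (by positivity) hlog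
  have hexp : (d + 1) * c ≤ c * (d + 1) ^ c := by
    rw [mul_comm]
    exact Nat.mul_le_mul_left _ (Nat.le_self_pow (by omega) _)
  rw [rootSizeBound, mul_pow, ← pow_mul]
  push_cast
  refine mul_le_mul ?_ ?_ (by positivity) (by positivity)
  · exact le_mul_of_one_le_left (by positivity) (by exact_mod_cast hc)
  · calc (ρ : ℝ) ^ ((d + 1) * c) ≤ ρ ^ (c * (d + 1) ^ c) := pow_le_pow_right₀ hρ' hexp
      _ ≤ _ := pow_le_pow_left₀ (by positivity) hbase _

theorem rootSizeBound_nonneg {c s D k ρ d : ℕ} (hk : 1 < k) :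
    0 ≤ rootSizeBound c s D k ρ d := by
  have : 0 ≤ Real.logb 2 k := Real.logb_nonneg (by norm_num) (by exact_mod_cast hk.le)
  unfold rootSizeBound
  positivity

/-- If the generator maps a nonzero `A(T, x, Φ(T, x))` to zero, then it maps some nonzero coefficient
of it with respect to `T` to zero, and this coefficient is cheap. -/
theorem computableBy_of_substZ_KI_eq_zero {F : Type*} [Field F] [CharZero F]
    {n σ μ ρ k Δ s : ℕ} {A : MvPolynomial (VarTXZ (Fin n)) F} {Φ : MvPolynomial (VarTX (Fin n)) F}
    (𝒮 : Design n σ μ ρ) (g : MvPolynomial (Fin σ) F) (hk : 1 < k) (hA : ComputableBy A Δ s)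
    (hreg : TRegularized A) (hroot : IsApproxRoot A Φ k) (htr : IsTruncated Φ k)
    (hnd : IsNondegenerate A Φ) (hne : substZ A Φ ≠ 0)
    (hz : substZ (substXInTXZ (KI g 𝒮) A) (substXInTX (KI g 𝒮) Φ) = 0) :
    ComputableBy g (Δ + 132) (rootSizeBound 132 s A.totalDegree k ρ g.totalDegree) := by
  have hne' : viewT (substZ A Φ) ≠ 0 := fun h => hne (viewT_injective (h.trans (map_zero _).symm))
  obtain ⟨i, hi⟩ : ∃ i, (viewT (substZ A Φ)).coeff i ≠ 0 := by
    by_contra! h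
    exact hne' (Polynomial.ext h)
  have hKI : MvPolynomial.aeval (KI g 𝒮) ((viewT (substZ A Φ)).coeff i) = 0 := by
    rw [substZ_substXInTXZ] at hz
    have h1 := congrArg (fun p => (viewT p).coeff i) hz
    simp only [viewT_substXInTX, Polynomial.coeff_map, map_zero, Polynomial.coeff_zero] at h1
    exact h1
  -- For `ρ ≤ 1` the size bound has no factor depending on `d`, but then `g` is constant.
  rcases Nat.lt_or_ge ρ 2 with hρ | hρ
  · obtain ⟨c, rfl⟩ := exists_eq_C_of_KI_eq_zero 𝒮 g hi hKI (by omega)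
    exact (computableBy_C c _ 0).mono le_rfl (by rw [Nat.cast_zero]; exact rootSizeBound_nonneg hk)
  · set d := g.totalDegree with hd
    -- `M` bounds `s`, `deg A`, `k`, `d + 1` and the number `ρ ^ d` of monomials of restrictions of `g`.
    set M := (s + A.totalDegree + k) * ρ ^ (d + 1) with hMdef
    have hpow : d + 1 ≤ ρ ^ (d + 1) := (Nat.lt_pow_self hρ).le
    have hpos : 1 ≤ ρ ^ (d + 1) := by omega
    have hle : s + A.totalDegree + k ≤ M := Nat.le_mul_of_pos_right _ hpos
    have hle' : ρ ^ (d + 1) ≤ M := Nat.le_mul_of_pos_left _ (by omega)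
    have hM : 2 ≤ M := by omega
    have hA' : Comp M Δ 1 1 A := by
      refine ⟨hA.mono le_rfl ?_, by rw [pow_one]; omega⟩
      exact_mod_cast (show s ≤ M ^ 1 by rw [pow_one]; omega)
    have hq := Comp.coeff_viewT_substZ hM (by omega) (by omega) hA' hreg hroot htr hnd i
    have hg := Comp.of_KI_eq_zero hM 𝒮 g hi hKI (by omega) (hpow.trans hle')
      ((Nat.pow_le_pow_right (by omega) (Nat.le_succ d)).trans hle') hq
    exact (hg.mono hM (Δ' := Δ + 132) (a' := 132) (by omega) (by omega) le_rfl).1.mono le_rfl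
      (pow_le_rootSizeBound (by norm_num) hk (by omega))

end

theorem theorem7p2 :
    -- `c` is an absolute constant: it governs the `O(1)` in the depth and both polynomials
    ∃ c : ℕ, ∀ (F : Type*) [Field F] [CharZero F] (n σ μ ρ k Δ s : ℕ)
      (A : MvPolynomial (VarTXZ (Fin n)) F) (Φ : MvPolynomial (VarTX (Fin n)) F)
      (𝒮 : Design n σ μ ρ) (g : MvPolynomial (Fin σ) F),
      1 < k →
      ComputableBy A Δ s →
      TRegularized A →
      MonicInZ A →
      IsApproxRoot A Φ k →
      IsTruncated Φ k →
      IsNondegenerate A Φ →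
      (substZ A Φ ≠ 0 →
        substZ (substXInTXZ (KI g 𝒮) A) (substXInTX (KI g 𝒮) Φ) = 0 →
        ComputableBy g (Δ + c) (rootSizeBound c s A.totalDegree k ρ g.totalDegree)) ∧
      (¬ ComputableBy g (Δ + c) (rootSizeBound c s A.totalDegree k ρ g.totalDegree) →
        (substZ (substXInTXZ (KI g 𝒮) A) (substXInTX (KI g 𝒮) Φ) = 0 ↔ substZ A Φ = 0)) := by
  -- Both the depth overhead `39` and the exponent `132` of `M` come from adding up the construction.
  refine ⟨132, fun F _ _ n σ μ ρ k Δ s A Φ 𝒮 g hk hA hreg _ hroot htr hnd => ?_⟩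
  have key := computableBy_of_substZ_KI_eq_zero 𝒮 g hk hA hreg hroot htr hnd
  refine ⟨key, fun hg => ⟨fun hz => ?_, fun hz => ?_⟩⟩
  · by_contra hne
    exact hg (key hne hz)
  · rw [substZ_substXInTXZ, hz]
    simp [substXInTX]
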